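/- **Model.** Two matroids $\mathcal M_1,\mathcal M_2$ on a ground set $\mathcal N$ with $|\mathcal N|=n$ are known to both parties. Alice receives $\mathcal N_A\subseteq\mathcal N$ and Bob receives $\mathcal N_B\subseteq\mathcal N\setminus\mathcal N_A$; the instance is the pair of matroids restricted to $E=\mathcal N_A\cup\mathcal N_B$. In the weighted problem the elements of $E$ have positive real weights $w$, each party sees only the weights of its own elements, and both parties know a bound $W\ge 1$ on the aspect ratio, i.e. $w(e)\le W\,w(f)$ for all $e,f\in E$. In a one-way protocol Alice sends one bit string to Bob, who, from it and his own input, outputs a common independent set contained in $E$. Protocols may use finitely many shared coin tosses; a protocol is an $\alpha$-approximation if on every instance the output is always a common independent set in $E$ and its expected cardinality (resp. weight) is at least $\alpha$ times the maximum. A protocol is deterministic if its coins have a single outcome; the expectation is then the value itself. The number of bits is the length of Alice's message, in the worst case over the coins. For $\varepsilon>0$ let $\gamma_\varepsilon=\lceil(1/\varepsilon)^{1/\varepsilon}\rceil$. **Lemma.** There are absolute constants $c\ge 1$ and $K>0$ such that the following holds for all $\varepsilon>0$ and $\alpha\in(0,1]$. Let $\mathcal P_u$ be an $\alpha$-approximate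 one-way two-party protocol for unweighted (maximum cardinality) matroid intersection that uses at most $C_u(n,r)$ bits on every instance with $|\mathcal N|=n$ whose maximum common independent set has at most $r$ elements. Then there is an $\alpha(1-\varepsilon)$-approximate one-way two-party protocol $\mathcal P_w$ for weighted matroid intersection that uses at most $$K\cdot C_u(\gamma_{\varepsilon/c}\,n,\ \gamma_{\varepsilon/c}\,r)\cdot(1+\log W)$$ bits on every instance with $|\mathcal N|=n$ and aspect ratio at most $W$ whose maximum cardinality common independent set has at most $r$ elements. If $\mathcal P_u$ is deterministic, then so is $\mathcal P_w$. -/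

import Mathlib

open scoped BigOperators

/-- A randomized one-way two-party protocol with shared random coins.  Alice holds `x : X` and sends
one message, a bit string, to Bob; Bob holds `y : Y` and answers from `y` and the message alone. -/
structure OneWayProtocol (X Y Z : Type) where
  /-- The outcomes of the shared coin tosses. -/
  Coins : Type
  /-- Finitely many coin tosses are made. -/
  [fintypeCoins : Fintype Coins]
  /-- The distribution of the coin tosses. -/
  law : PMF Coins
  /-- Alice's message. -/
  message : Coins → X → List Bool
  /-- Bob's answer. -/
  output : Coins → Y → List Bool → Z

attribute [instance] OneWayProtocol.fintypeCoins

namespace OneWayProtocol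

variable {X Y Z : Type}

/-- Bob's answer when the protocol is run on Alice's input `x` and Bob's input `y`. -/
def run (P : OneWayProtocol X Y Z) (ω : P.Coins) (x : X) (y : Y) : Z :=
  P.output ω y (P.message ω x)

/-- The expectation of `f` over the coin tosses. -/
noncomputable def expect (P : OneWayProtocol X Y Z) (f : P.Coins → ℝ) : ℝ :=
  ∑ ω, (P.law ω).toReal * f ω

/-- A protocol is deterministic if its coins have only one outcome. -/
def IsDeterministic (P : OneWayProtocol X Y Z) : Prop :=
  Subsingleton P.Coins

end OneWayProtocol

/-- Two matroids on the ground set `Fin n`. -/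
structure MatroidPair (n : ℕ) where
  /-- The first matroid. -/
  M₁ : Matroid (Fin n)
  /-- The second matroid. -/
  M₂ : Matroid (Fin n)
  ground₁ : M₁.E = Set.univ
  ground₂ : M₂.E = Set.univ

namespace MatroidPair

variable {n : ℕ}

/-- `S` is a common independent set of the restrictions of the two matroids to `X`. -/
def CommonIndep (M : MatroidPair n) (X S : Finset (Fin n)) : Prop :=
  S ⊆ X ∧ M.M₁.Indep (S : Set (Fin n)) ∧ M.M₂.Indep (S : Set (Fin n))

open Classical in
/-- The maximum cardinality of a common independent set of the restrictions to `X`. -/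
noncomputable def commonRank (M : MatroidPair n) (X : Finset (Fin n)) : ℕ :=
  (X.powerset.filter (M.CommonIndep X)).sup Finset.card

end MatroidPair

/-- A party's input in the unweighted problem: the matroids, which both parties know, and the
elements of the instance that this party holds. -/
structure Share (n : ℕ) where
  /-- The matroids. -/
  matroids : MatroidPair n
  /-- The elements held by the party. -/
  elements : Finset (Fin n)

/-- A party's input in the weighted problem: a party sees the weights of its own elements only. -/
structure WeightedShare (n : ℕ) extends Share n where
  /-- The weights of the party's elements. -/
  weight : elements → ℝ

/-- The share of a party that holds `A`, when the weights of the instance are given by `w`. -/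
def WeightedShare.ofWeights {n : ℕ} (M : MatroidPair n) (A : Finset (Fin n)) (w : Fin n → ℝ) :
    WeightedShare n :=
  ⟨⟨M, A⟩, fun e => w e⟩

/-- One-way protocols for unweighted matroid intersection on the ground set `Fin n`. -/
abbrev UnweightedProtocol (n : ℕ) := OneWayProtocol (Share n) (Share n) (Finset (Fin n))

/-- One-way protocols for weighted matroid intersection on the ground set `Fin n`. -/
abbrev WeightedProtocol (n : ℕ) :=
  OneWayProtocol (WeightedShare n) (WeightedShare n) (Finset (Fin n))

namespace UnweightedProtocol

variable {n : ℕ}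

/-- On every instance, split into Alice's part `A` and Bob's part `B`, Bob outputs a common
independent set of the matroids restricted to `A ∪ B`, of expected cardinality at least `α` times
the maximum. -/
def IsApprox (P : UnweightedProtocol n) (α : ℝ) : Prop :=
  ∀ (M : MatroidPair n) (A B : Finset (Fin n)), Disjoint A B →
    (∀ ω, M.CommonIndep (A ∪ B) (P.run ω ⟨M, A⟩ ⟨M, B⟩)) ∧
    α * (M.commonRank (A ∪ B) : ℝ) ≤
      P.expect fun ω => ((P.run ω ⟨M, A⟩ ⟨M, B⟩).card : ℝ)

/-- Alice sends at most `C r` bits whenever the maximum common independent set of the instance has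
at most `r` elements. -/
def UsesBits (P : UnweightedProtocol n) (C : ℕ → ℝ) : Prop :=
  ∀ (M : MatroidPair n) (A B : Finset (Fin n)), Disjoint A B →
    ∀ r : ℕ, M.commonRank (A ∪ B) ≤ r →
      ∀ ω, ((P.message ω ⟨M, A⟩).length : ℝ) ≤ C r

end UnweightedProtocol

/-- The weights on `X` are positive and their ratios are at most `W`. -/
def HasAspectRatio {n : ℕ} (X : Finset (Fin n)) (w : Fin n → ℝ) (W : ℝ) : Prop :=
  (∀ e ∈ X, 0 < w e) ∧ ∀ e ∈ X, ∀ f ∈ X, w e ≤ W * w f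

namespace WeightedProtocol

variable {n : ℕ}

/-- On every instance whose weights have aspect ratio at most `W`, Bob outputs a common independent
set of expected weight at least `α` times the weight of every common independent set. -/
def IsApprox (P : WeightedProtocol n) (W α : ℝ) : Prop :=
  ∀ (M : MatroidPair n) (A B : Finset (Fin n)) (w : Fin n → ℝ), Disjoint A B →
    HasAspectRatio (A ∪ B) w W →
    (∀ ω, M.CommonIndep (A ∪ B)
      (P.run ω (.ofWeights M A w) (.ofWeights M B w))) ∧
    ∀ T, M.CommonIndep (A ∪ B) T →
      α * ∑ e ∈ T, w e ≤
        P.expect fun ω => ∑ e ∈ P.run ω (.ofWeights M A w) (.ofWeights M B w), w e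

/-- Alice sends at most `C r` bits whenever the weights have aspect ratio at most `W` and the
maximum cardinality common independent set of the instance has at most `r` elements. -/
def UsesBits (P : WeightedProtocol n) (W : ℝ) (C : ℕ → ℝ) : Prop :=
  ∀ (M : MatroidPair n) (A B : Finset (Fin n)) (w : Fin n → ℝ), Disjoint A B →
    HasAspectRatio (A ∪ B) w W →
    ∀ r : ℕ, M.commonRank (A ∪ B) ≤ r →
      ∀ ω, ((P.message ω (.ofWeights M A w)).length : ℝ) ≤ C r

end WeightedProtocol

/-- `γ_ε = ⌈(1/ε)^(1/ε)⌉`. -/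
noncomputable def gammaFactor (ε : ℝ) : ℕ :=
  ⌈(1 / ε) ^ (1 / ε)⌉₊

/-! For integral weights, the reduction to cardinality is by unfolding. An element `e` of weight `v`
is replaced by `v` copies `(j, k)` with `j + k + 1 = v`; the first matroid treats copies with
different `j` independently, the second those with different `k`. All copies of a common independent
set form a common independent set, so the unfolded optimum is at least the weighted one. Conversely,
`exists_commonIndep_card_le_weight` folds any common independent set of copies into one among the
copied elements that weighs at least the number of copies. This rests on Frank's weight splitting `u
+ v = w`: each copy has `j < u e` or `k < v e`, and counting layer by layer bounds the copies of the
first kind by the `u`-weight of an optimal base and those of the second by its `v`-weight.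

General weights are cut into geometric classes. For an offset `j`, elements whose base-`b` logarithm
is congruent to `j` modulo `p` are dropped. The rest fall into classes spanning less than `b ^ p`,
separated by a factor of at least `b`, and rounding down in a class costs a factor `1 + 1 / b`. Some
offset loses at most a fraction `1 / p` of a given optimum. Since classes are far apart, their
folded solutions merge greedily from heavy to light at a cost of `1 + 4 / b`.

The parties know only the ratio `W`, not the absolute magnitude of the weights. Scales are therefore
taken modulo `N`, with `b ^ N` so large that one instance uses at most one scale per residue (slot).
The unweighted protocol is run on every slot with the same coins, about `log W` runs in all. Bob
does not learn the weights of Alice's elements exactly, but the surviving copies reveal rounded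
weights and slots. He optimizes for any weights consistent with them: these agree with the true ones
up to rounding and one common power of `b ^ N`, which costs `(1 + 1 / b) ^ 2`. The offset enters
only the analysis, and linearity of expectation over the slots finishes the proof. -/

set_option linter.unusedSectionVars false

/-! ### Symmetric exchange and the matroid intersection theorem -/

namespace Matroid

/-- The symmetric exchange property of the bases of a matroid. -/
theorem IsBase.exists_symm_exchange {α : Type*} {M : Matroid α} {B B' : Set α} {e : α}
    (hB : M.IsBase B) (hB' : M.IsBase B') (heB : e ∈ B) (heB' : e ∉ B') :
    ∃ f ∈ B', f ∉ B ∧ M.IsBase (insert f (B \ {e})) ∧ M.IsBase (insert e (B' \ {f})) := by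
  have heE : e ∈ M.E := hB.subset_ground heB
  have hC := hB'.fundCircuit_isCircuit heE heB'
  have hecl : e ∈ M.closure B' := by rwa [hB'.closure_eq]
  -- The fundamental circuit without `e` still spans `e`, while `B \ {e}` does not; so some circuit
  -- element lies outside that closure.
  obtain ⟨f, hf, hfcl⟩ : ∃ f ∈ M.fundCircuit e B' \ {e}, f ∉ M.closure (B \ {e}) := by
    by_contra! h
    have h1 : e ∈ M.closure (M.fundCircuit e B' \ {e}) :=
      hC.mem_closure_sdiff_singleton_of_mem (M.mem_fundCircuit e B')
    have h2 : M.closure (M.fundCircuit e B' \ {e}) ⊆ M.closure (B \ {e}) := by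
      refine M.closure_subset_closure_of_subset_closure h
    exact hB.indep.notMem_closure_sdiff_of_mem heB (h2 h1)
  have hfB' : f ∈ B' := by
    rcases M.fundCircuit_subset_insert e B' hf.1 with h | h
    · exact absurd h hf.2
    · exact h
  have hfE : f ∈ M.E := hB'.subset_ground hfB'
  have hfe : f ≠ e := hf.2
  have hfB : f ∉ B := fun h =>
    hfcl (M.mem_closure_of_mem' ⟨h, hfe⟩ hfE)
  refine ⟨f, hfB', hfB, hB.exchange_base_of_notMem_closure heB hfcl, ?_⟩
  have h3 := (hB'.indep.mem_fundCircuit_iff hecl heB').1 hf.1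
  rw [Set.insert_sdiff_singleton_comm hfe.symm]
  exact hB'.exchange_isBase_of_indep' hfB' heB' h3

variable {α : Type*} [Fintype α] [DecidableEq α]

/-- The rank of a finset in a matroid on a finite type, as a natural number. -/
noncomputable def finRank (M : Matroid α) (X : Finset α) : ℕ := (M.eRk (X : Set α)).toNat

theorem coe_finRank (M : Matroid α) (X : Finset α) :
    (M.finRank X : ℕ∞) = M.eRk (X : Set α) :=
  ENat.natCast_toNat (by simp)

theorem Indep.card_le_finRank {M : Matroid α} {I X : Finset α} (hI : M.Indep (I : Set α))
    (hIX : I ⊆ X) : I.card ≤ M.finRank X := by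
  have h := hI.encard_le_eRk_of_subset (Finset.coe_subset.2 hIX)
  rw [← coe_finRank, Set.encard_coe_eq_coe_finsetCard] at h
  exact_mod_cast h

theorem Indep.finRank_eq_card {M : Matroid α} {I : Finset α} (hI : M.Indep (I : Set α)) :
    M.finRank I = I.card := by
  have h := hI.eRk_eq_encard
  rw [← coe_finRank, Set.encard_coe_eq_coe_finsetCard] at h
  exact_mod_cast h

theorem Indep.exists_card_eq_finRank {M : Matroid α} {I X : Finset α} (hI : M.Indep (I : Set α))
    (hIX : I ⊆ X) :
    ∃ J : Finset α, I ⊆ J ∧ J ⊆ X ∧ M.Indep (J : Set α) ∧ J.card = M.finRank X := by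
  obtain ⟨J, hJ, hIJ⟩ := hI.subset_isBasis'_of_subset (Finset.coe_subset.2 hIX)
  refine ⟨(Set.toFinite J).toFinset, by simpa [Finset.subset_iff, Set.subset_def] using hIJ,
    by simpa [Finset.subset_iff, Set.subset_def] using hJ.subset, by simpa using hJ.indep, ?_⟩
  have h := hJ.encard_eq_eRk
  rw [← coe_finRank, (Set.toFinite J).encard_eq_coe_toFinset_card] at h
  exact_mod_cast h

theorem finRank_mono (M : Matroid α) {X Y : Finset α} (h : X ⊆ Y) : M.finRank X ≤ M.finRank Y := by
  have := M.eRk_mono (Finset.coe_subset.2 h)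
  rw [← coe_finRank, ← coe_finRank] at this
  exact_mod_cast this

theorem finRank_submod (M : Matroid α) (X Y : Finset α) :
    M.finRank (X ∩ Y) + M.finRank (X ∪ Y) ≤ M.finRank X + M.finRank Y := by
  have h := M.eRk_inter_add_eRk_union_le (X : Set α) (Y : Set α)
  rw [← Finset.coe_inter, ← Finset.coe_union, ← coe_finRank, ← coe_finRank, ← coe_finRank,
    ← coe_finRank] at h
  exact_mod_cast h

theorem finRank_insert_of_not_indep (M : Matroid α) {C : Finset α} {e : α}
    (hC : M.Indep (C : Set α)) (he : ¬ M.Indep ((insert e C : Finset α) : Set α))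
    (Y : Finset α) (hCY : C ⊆ Y) : M.finRank (insert e Y) = M.finRank Y := by
  refine le_antisymm ?_ (M.finRank_mono (Finset.subset_insert e Y))
  have h1 : M.finRank (insert e C) ≤ C.card := by
    obtain ⟨J, hCJ, hJ, hJi, hJc⟩ := hC.exists_card_eq_finRank (Finset.subset_insert e C)
    rw [← hJc]
    by_contra! h
    refine he ?_
    rwa [← Finset.eq_of_subset_of_card_le hJ]
    exact (Finset.card_insert_le e C).trans h
  have h2 := M.finRank_submod (insert e C) Y
  have h3 : C.card ≤ M.finRank (insert e C ∩ Y) :=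
    hC.card_le_finRank (Finset.subset_inter (Finset.subset_insert e C) hCY)
  have h4 : insert e C ∪ Y = insert e Y := by
    rw [Finset.insert_union, Finset.union_eq_right.2 hCY]
  rw [h4] at h2
  omega

/-- The matroid intersection theorem, with a contracted common independent set `C`. -/
theorem exists_commonIndep_finRank_le_aux (M N : Matroid α) (R : Finset α) :
    ∀ C : Finset α, Disjoint C R → M.Indep (C : Set α) → N.Indep (C : Set α) →
      ∃ I Y : Finset α, I ⊆ R ∧ Y ⊆ R ∧ M.Indep ((C ∪ I : Finset α) : Set α) ∧
        N.Indep ((C ∪ I : Finset α) : Set α) ∧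
        M.finRank (C ∪ Y) + N.finRank (C ∪ (R \ Y)) ≤ I.card + 2 * C.card := by
  induction R using Finset.induction_on with
  | empty =>
    intro C _ hM hN
    refine ⟨∅, ∅, by simp, by simp, by simpa using hM, by simpa using hN, ?_⟩
    simp [hM.finRank_eq_card, hN.finRank_eq_card]
    omega
  | insert e R heR ih =>
    intro C hCR hM hN
    have heC : e ∉ C := fun h => (Finset.disjoint_left.1 hCR h) (Finset.mem_insert_self e R)
    have hCR' : Disjoint C R := hCR.mono_right (Finset.subset_insert e R)
    obtain ⟨I, Y, hIR, hYR, hMI, hNI, hr⟩ := ih C hCR' hM hN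
    have heY : e ∉ Y := fun h => heR (hYR h)
    by_cases hMe : M.Indep ((insert e C : Finset α) : Set α)
    swap
    · refine ⟨I, insert e Y, hIR.trans (Finset.subset_insert e R),
        Finset.insert_subset_insert e hYR, hMI, hNI, ?_⟩
      rw [Finset.union_insert, M.finRank_insert_of_not_indep hM hMe _ Finset.subset_union_left,
        Finset.insert_sdiff_insert, Finset.sdiff_insert_of_notMem heR]
      exact hr
    by_cases hNe : N.Indep ((insert e C : Finset α) : Set α)
    swap
    · refine ⟨I, Y, hIR.trans (Finset.subset_insert e R),
        hYR.trans (Finset.subset_insert e R), hMI, hNI, ?_⟩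
      rw [Finset.insert_sdiff_of_notMem _ heY, Finset.union_insert,
        N.finRank_insert_of_not_indep hN hNe _ Finset.subset_union_left]
      exact hr
    obtain ⟨I', Y', hIR', hYR', hMI', hNI', hr'⟩ := ih (insert e C)
      (Finset.disjoint_insert_left.2 ⟨heR, hCR'⟩) hMe hNe
    have heY' : e ∉ Y' := fun h => heR (hYR' h)
    have heI' : e ∉ I' := fun h => heR (hIR' h)
    rw [Finset.card_insert_of_notMem heC] at hr'
    -- Uncross the dual sets obtained by deleting `e` (`Y`) and by contracting it (`Y'`): the
    -- candidates are `Y ∩ Y'` and `insert e (Y ∪ Y')`.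
    have s1 := M.finRank_submod (C ∪ Y) (insert e C ∪ Y')
    have s2 := N.finRank_submod (C ∪ (R \ Y)) (insert e C ∪ (R \ Y'))
    have e1 : (C ∪ Y) ∩ (insert e C ∪ Y') = C ∪ (Y ∩ Y') := by ext x; grind
    have e2 : (C ∪ Y) ∪ (insert e C ∪ Y') = C ∪ insert e (Y ∪ Y') := by ext x; grind
    have e3 : (C ∪ (R \ Y)) ∩ (insert e C ∪ (R \ Y')) =
        C ∪ (insert e R \ insert e (Y ∪ Y')) := by ext x; grind
    have e4 : (C ∪ (R \ Y)) ∪ (insert e C ∪ (R \ Y')) = C ∪ (insert e R \ (Y ∩ Y')) := by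
      ext x; grind
    rw [e1, e2] at s1
    rw [e3, e4] at s2
    have key : ∃ J : Finset α, J ⊆ insert e R ∧ M.Indep ((C ∪ J : Finset α) : Set α) ∧
        N.Indep ((C ∪ J : Finset α) : Set α) ∧ I.card ≤ J.card ∧ I'.card + 1 ≤ J.card := by
      by_cases h : I'.card + 1 ≤ I.card
      · exact ⟨I, hIR.trans (Finset.subset_insert e R), hMI, hNI, le_rfl, h⟩
      · have e5 : C ∪ insert e I' = insert e C ∪ I' := by ext x; grind
        refine ⟨insert e I', Finset.insert_subset_insert e hIR', by rwa [e5], by rwa [e5], ?_, ?_⟩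
        all_goals rw [Finset.card_insert_of_notMem heI']
        omega
    obtain ⟨J, hJR, hMJ, hNJ, hJ1, hJ2⟩ := key
    -- The two candidates have total rank at most `2 * J.card + 4 * C.card + 1`, so by integrality
    -- one of them meets the bound.
    by_cases hc : M.finRank (C ∪ (Y ∩ Y')) + N.finRank (C ∪ (insert e R \ (Y ∩ Y'))) ≤
        J.card + 2 * C.card
    · exact ⟨J, Y ∩ Y', hJR, by grind, hMJ, hNJ, hc⟩
    · exact ⟨J, insert e (Y ∪ Y'), hJR, by grind, hMJ, hNJ, by omega⟩

/-- The matroid intersection theorem. -/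
theorem exists_commonIndep_finRank_le (M N : Matroid α) :
    ∃ I Y : Finset α, M.Indep (I : Set α) ∧ N.Indep (I : Set α) ∧
      M.finRank Y + N.finRank Yᶜ ≤ I.card := by
  obtain ⟨I, Y, -, -, h1, h2, h3⟩ := exists_commonIndep_finRank_le_aux M N Finset.univ ∅
    (by simp) (by simp) (by simp)
  refine ⟨I, Y, by simpa using h1, by simpa using h2, ?_⟩
  simpa [Finset.compl_eq_univ_sdiff] using h3

end Matroid

/-! ### Bases of maximum weight and weight splitting -/

namespace Matroid

variable {α : Type*} [Fintype α] [DecidableEq α]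

/-- A base of maximum weight. -/
def IsMaxBase (M : Matroid α) (w : α → ℤ) (B : Finset α) : Prop :=
  M.IsBase (B : Set α) ∧ ∀ B' : Finset α, M.IsBase (B' : Set α) → ∑ x ∈ B', w x ≤ ∑ x ∈ B, w x

theorem exists_isBase_finset (M : Matroid α) : ∃ B : Finset α, M.IsBase (B : Set α) := by
  obtain ⟨B, hB⟩ := M.exists_isBase
  exact ⟨(Set.toFinite B).toFinset, by simpa using hB⟩

theorem exists_isMaxBase (M : Matroid α) (w : α → ℤ) : ∃ B, M.IsMaxBase w B := by
  classical
  obtain ⟨B₀, hB₀⟩ := M.exists_isBase_finset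
  obtain ⟨B, hB, hmax⟩ := Finset.exists_max_image
    (Finset.univ.filter fun B : Finset α => M.IsBase (B : Set α)) (fun B => ∑ x ∈ B, w x)
    ⟨B₀, by simpa using hB₀⟩
  exact ⟨B, by simpa using hB, fun B' hB' => hmax B' (by simpa using hB')⟩

theorem IsBase.card_eq_card {M : Matroid α} {B B' : Finset α} (hB : M.IsBase (B : Set α))
    (hB' : M.IsBase (B' : Set α)) : B.card = B'.card := by
  simpa using hB.ncard_eq_ncard_of_isBase hB'

theorem Indep.isBase_of_card_le {M : Matroid α} {I B : Finset α} (hI : M.Indep (I : Set α))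
    (hB : M.IsBase (B : Set α)) (h : B.card ≤ I.card) : M.IsBase (I : Set α) := by
  obtain ⟨B', hB', hIB⟩ := hI.exists_isBase_superset
  lift B' to Finset α using Set.toFinite B'
  rwa [Finset.eq_of_subset_of_card_le (Finset.coe_subset.1 hIB) (hB'.card_eq_card hB ▸ h)]

theorem IsBase.exists_symm_exchange_finset {M : Matroid α} {B B' : Finset α} {e : α}
    (hB : M.IsBase (B : Set α)) (hB' : M.IsBase (B' : Set α)) (he : e ∈ B) (he' : e ∉ B') :
    ∃ f ∈ B', f ∉ B ∧ M.IsBase ((insert f (B.erase e) : Finset α) : Set α) ∧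
      M.IsBase ((insert e (B'.erase f) : Finset α) : Set α) := by
  obtain ⟨f, h1, h2, h3, h4⟩ := hB.exists_symm_exchange hB' (Finset.mem_coe.2 he)
    (by simpa using he')
  exact ⟨f, by simpa using h1, by simpa using h2, by simpa using h3, by simpa using h4⟩

theorem sum_insert_erase {B : Finset α} {e f : α} (w : α → ℤ) (he : e ∈ B) (hf : f ∉ B) :
    ∑ x ∈ insert f (B.erase e), w x = ∑ x ∈ B, w x + w f - w e := by
  rw [Finset.sum_insert (fun h => hf (Finset.mem_of_mem_erase h)), ← Finset.add_sum_erase _ _ he]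
  ring

/-- Symmetric exchange between two bases of maximum weight stays among them. -/
theorem IsMaxBase.exists_symm_exchange {M : Matroid α} {w : α → ℤ} {B B' : Finset α} {e : α}
    (hB : M.IsMaxBase w B) (hB' : M.IsMaxBase w B') (he : e ∈ B) (he' : e ∉ B') :
    ∃ f ∈ B', f ∉ B ∧ M.IsMaxBase w (insert f (B.erase e)) := by
  obtain ⟨f, hf, hfB, h3, h4⟩ := hB.1.exists_symm_exchange_finset hB'.1 he he'
  -- The exchange changes the two weights by opposite amounts, and maximality of `B'` forces `w e ≤
  -- w f`.
  refine ⟨f, hf, hfB, h3, fun B'' hB'' => (hB.2 _ hB'').trans ?_⟩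
  have := hB'.2 _ h4
  rw [sum_insert_erase w hf he'] at this
  rw [sum_insert_erase w he hfB]
  linarith

/-- The matroid whose bases are the bases of maximum weight. -/
def maxWeight (M : Matroid α) (w : α → ℤ) : Matroid α :=
  Matroid.ofIsBaseOfFinite (E := Set.univ) Set.finite_univ
    (fun B => ∃ B' : Finset α, (B' : Set α) = B ∧ M.IsMaxBase w B')
    (by obtain ⟨B, hB⟩ := M.exists_isMaxBase w; exact ⟨B, B, rfl, hB⟩)
    (by
      rintro _ _ ⟨B, rfl, hB⟩ ⟨B', rfl, hB'⟩ e he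
      obtain ⟨f, hf, hfB, h⟩ := hB.exists_symm_exchange hB' (e := e) (by simpa using he.1)
        (by simpa using he.2)
      exact ⟨f, ⟨by simpa using hf, by simpa using hfB⟩, _, by simp, h⟩)
    (fun _ _ => Set.subset_univ _)

theorem maxWeight_isBase_iff (M : Matroid α) (w : α → ℤ) (B : Finset α) :
    (M.maxWeight w).IsBase (B : Set α) ↔ M.IsMaxBase w B := by
  change (∃ B' : Finset α, (B' : Set α) = (B : Set α) ∧ M.IsMaxBase w B') ↔ _
  simp only [Finset.coe_inj, exists_eq_left]

theorem exists_indep_card_eq_finRank (M : Matroid α) (X : Finset α) :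
    ∃ J : Finset α, J ⊆ X ∧ M.Indep (J : Set α) ∧ J.card = M.finRank X := by
  have h : M.Indep ((∅ : Finset α) : Set α) := by simp
  obtain ⟨J, -, h⟩ := h.exists_card_eq_finRank (Finset.empty_subset X)
  exact ⟨J, h⟩

theorem card_inter_eq_sum (B Y : Finset α) :
    ((B ∩ Y).card : ℤ) = ∑ x ∈ B, if x ∈ Y then (1 : ℤ) else 0 := by
  rw [Finset.sum_boole, Finset.filter_mem_eq_inter]

/-- A base of maximum weight which meets `Y` in as many elements as possible has maximum weight
also after the weights on `Y` are raised by one. -/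
theorem exists_isMaxBase_add_indicator (M : Matroid α) (w : α → ℤ) (Y : Finset α) :
    ∃ B : Finset α, M.IsMaxBase w B ∧ (B ∩ Y).card = (M.maxWeight w).finRank Y ∧
      M.IsMaxBase (fun x => w x + if x ∈ Y then 1 else 0) B := by
  obtain ⟨J, hJY, hJ, hJc⟩ := (M.maxWeight w).exists_indep_card_eq_finRank Y
  obtain ⟨B, hB, hJB⟩ := hJ.exists_isBase_superset
  lift B to Finset α using Set.toFinite B
  have hJB' : J ⊆ B := Finset.coe_subset.1 hJB
  have hmax : ∀ B', M.IsMaxBase w B' → (B' ∩ Y).card ≤ (M.maxWeight w).finRank Y := by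
    intro B' hB'
    have h1 : (M.maxWeight w).Indep ((B' ∩ Y : Finset α) : Set α) :=
      ((maxWeight_isBase_iff M w B').2 hB').indep.subset
        (Finset.coe_subset.2 Finset.inter_subset_left)
    exact h1.card_le_finRank Finset.inter_subset_right
  rw [maxWeight_isBase_iff] at hB
  have hBc : (B ∩ Y).card = (M.maxWeight w).finRank Y :=
    le_antisymm (hmax B hB) (hJc ▸ Finset.card_le_card (Finset.subset_inter hJB' hJY))
  refine ⟨B, hB, hBc, hB.1, ?_⟩
  -- Move `B'` toward `B` by symmetric exchanges; no such exchange lowers the raised weight of `B'`.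
  have key : ∀ n : ℕ, ∀ B' : Finset α, M.IsBase (B' : Set α) → (B \ B').card = n →
      ∑ x ∈ B', (w x + if x ∈ Y then 1 else 0) ≤ ∑ x ∈ B, (w x + if x ∈ Y then 1 else 0) := by
    intro n
    induction n with
    | zero =>
      intro B' hB' h
      rw [Finset.card_eq_zero, Finset.sdiff_eq_empty_iff_subset] at h
      rw [Finset.eq_of_subset_of_card_le h (hB'.card_eq_card hB.1).le]
    | succ n ih =>
      intro B' hB' h
      obtain ⟨e, he⟩ : (B \ B').Nonempty := Finset.card_pos.1 (by omega)
      rw [Finset.mem_sdiff] at he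
      obtain ⟨f, hf, hfB, h3, h4⟩ := hB.1.exists_symm_exchange_finset hB' he.1 he.2
      have h5 := ih _ h4 (by
        have : B \ insert e (B'.erase f) = (B \ B').erase e := by ext x; grind
        rw [this, Finset.card_erase_of_mem (by simpa using he)]
        omega)
      rw [sum_insert_erase _ hf he.2] at h5
      have h6 := hB.2 _ h3
      rw [sum_insert_erase w he.1 hfB] at h6
      have h7 : w f = w e → (if f ∈ Y then (1 : ℤ) else 0) ≤ if e ∈ Y then 1 else 0 := by
        intro hfe
        have h8 : M.IsMaxBase w (insert f (B.erase e)) := by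
          refine ⟨h3, fun B'' hB'' => (hB.2 B'' hB'').trans ?_⟩
          rw [sum_insert_erase w he.1 hfB]
          linarith
        have h9 : ((insert f (B.erase e) ∩ Y).card : ℤ) ≤ (B ∩ Y).card := by
          rw [hBc]
          exact_mod_cast hmax _ h8
        rw [card_inter_eq_sum, card_inter_eq_sum, sum_insert_erase _ he.1 hfB] at h9
        linarith
      -- A strict inequality of integral weights absorbs the increment of one; in a tie, the choice
      -- of `B` with the largest intersection with `Y` decides.
      have h10 : w f + (if f ∈ Y then (1 : ℤ) else 0) ≤ w e + if e ∈ Y then 1 else 0 := by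
        rcases lt_or_eq_of_le (show w f ≤ w e by linarith) with h | h
        · split_ifs <;> linarith
        · linarith [h7 h]
      linarith
  exact fun B' hB' => key _ B' hB' rfl

theorem IsMaxBase.sub_const {M : Matroid α} {w : α → ℤ} {B : Finset α} (hB : M.IsMaxBase w B)
    (c : ℤ) : M.IsMaxBase (fun x => w x - c) B := by
  refine ⟨hB.1, fun B' hB' => ?_⟩
  have h := hB.2 B' hB'
  have h' := hB'.card_eq_card hB.1
  simp only [Finset.sum_sub_distrib, Finset.sum_const, h']
  linarith

theorem IsMaxBase.sum_eq {M : Matroid α} {w : α → ℤ} {B B' : Finset α} (hB : M.IsMaxBase w B)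
    (hB' : M.IsMaxBase w B') : ∑ x ∈ B, w x = ∑ x ∈ B', w x :=
  le_antisymm (hB'.2 _ hB.1) (hB.2 _ hB'.1)

/-- Frank's weight splitting theorem for common bases. -/
theorem exists_weight_splitting (M N : Matroid α) (w : α → ℤ)
    (hMN : ∃ B : Finset α, M.IsBase (B : Set α) ∧ N.IsBase (B : Set α)) :
    ∃ (u v : α → ℤ) (B : Finset α), (∀ x, u x + v x = w x) ∧ M.IsMaxBase u B ∧
      N.IsMaxBase v B := by
  obtain ⟨B₀, hM₀, hN₀⟩ := hMN
  choose bM hbM using M.exists_isMaxBase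
  choose bN hbN using N.exists_isMaxBase
  -- The dual objective. It is integral and bounded below by the weight of a common base, so a
  -- minimizer exists.
  set D : (α → ℤ) → ℤ := fun u =>
    ∑ x ∈ bM u, u x + ∑ x ∈ bN (fun x => w x - u x), (w x - u x) with hD
  have hDlow : ∀ u, ∑ x ∈ B₀, w x ≤ D u := by
    intro u
    have h1 := (hbM u).2 B₀ hM₀
    have h2 := (hbN (fun x => w x - u x)).2 B₀ hN₀
    rw [Finset.sum_sub_distrib] at h2
    simp only [hD]
    linarith
  obtain ⟨u, hu⟩ : ∃ u, ∀ u', D u ≤ D u' := by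
    refine ⟨Function.argmin (fun u => (D u - ∑ x ∈ B₀, w x).toNat), fun u' => ?_⟩
    have h := Function.argmin_le (fun u => (D u - ∑ x ∈ B₀, w x).toNat) u'
    have h1 := hDlow u'
    have h2 := hDlow (Function.argmin (fun u => (D u - ∑ x ∈ B₀, w x).toNat))
    omega
  obtain ⟨I, Y, hMI, hNI, hr⟩ :=
    exists_commonIndep_finRank_le (M.maxWeight u) (N.maxWeight fun x => w x - u x)
  have hMb := (maxWeight_isBase_iff M u _).2 (hbM u)
  have hNb := (maxWeight_isBase_iff N _ _).2 (hbN (fun x => w x - u x))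
  have hMc := hM₀.card_eq_card (hbM u).1
  have hNc := hN₀.card_eq_card (hbN (fun x => w x - u x)).1
  by_cases hI : B₀.card ≤ I.card
  · refine ⟨u, fun x => w x - u x, I, fun x => by ring, ?_, ?_⟩
    · exact (maxWeight_isBase_iff M _ _).1 (hMI.isBase_of_card_le hMb (hMc ▸ hI))
    · exact (maxWeight_isBase_iff N _ _).1 (hNI.isBase_of_card_le hNb (hNc ▸ hI))
  exfalso
  -- The maximum-weight bases have no common member, so the min-max set `Y` is deficient. Shifting
  -- one unit of weight on `Y` from the second matroid to the first changes `D` by the rank of `Y`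
  -- plus the rank of `Yᶜ` minus the size of a base, which is negative.
  obtain ⟨B₁, h11, h12, h13⟩ := M.exists_isMaxBase_add_indicator u Y
  obtain ⟨B₂, h21, h22, h23⟩ := N.exists_isMaxBase_add_indicator (fun x => w x - u x) Yᶜ
  have h23' := h23.sub_const 1
  have heq : (fun x => (w x - u x + if x ∈ Yᶜ then (1 : ℤ) else 0) - 1) =
      fun x => w x - (u x + if x ∈ Y then 1 else 0) := by
    funext x
    by_cases hx : x ∈ Y
    · simp [hx]
      ring
    · simp [hx]
  have h3 := hu (fun x => u x + if x ∈ Y then 1 else 0)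
  have h4 := (hbM _).sum_eq h13
  have h5 : ∑ x ∈ bN (fun x => w x - (u x + if x ∈ Y then 1 else 0)),
      (w x - (u x + if x ∈ Y then 1 else 0)) =
      ∑ x ∈ B₂, (w x - u x) + ((∑ x ∈ B₂, if x ∈ Yᶜ then (1 : ℤ) else 0) - B₂.card) := by
    rw [heq] at h23'
    rw [(hbN _).sum_eq h23', ← heq, Finset.sum_sub_distrib, Finset.sum_add_distrib,
      Finset.sum_const, nsmul_eq_mul, mul_one]
    ring
  have h6 := (hbM u).sum_eq h11
  have h7 := (hbN _).sum_eq h21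
  have h8 := card_inter_eq_sum B₁ Y
  have h9 := card_inter_eq_sum B₂ Yᶜ
  have h10 := hN₀.card_eq_card h21.1
  rw [Finset.sum_add_distrib (s := B₁)] at h4
  simp only [hD] at h3
  rw [h4, h5, h6, h7, ← h8, ← h9, ← h10, h12, h22] at h3
  omega

end Matroid

/-! ### Folding layered copies, and extending common independent sets -/

namespace Matroid

variable {α : Type*} [Fintype α] [DecidableEq α]

theorem Indep.exists_insert_indep {M : Matroid α} {I J : Finset α} (hI : M.Indep (I : Set α))
    (hJ : M.Indep (J : Set α)) (h : I.card < J.card) :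
    ∃ e ∈ J, e ∉ I ∧ M.Indep ((insert e I : Finset α) : Set α) := by
  obtain ⟨e, he, h'⟩ := hI.augment hJ (by simpa [Set.encard_coe_eq_coe_finsetCard] using h)
  exact ⟨e, by simpa using he.1, by simpa using he.2, by simpa using h'⟩

/-- The restriction of a matroid to `R`, extended by free dummy elements and truncated, such that
every independent set becomes a base after adding dummies. -/
def pad (M : Matroid α) (R : Finset α) : Matroid (α ⊕ Option α) :=
  (IndepMatroid.ofFinset Set.univ
    (fun X => X.toLeft ⊆ R ∧ M.Indep (X.toLeft : Set α) ∧ X.card ≤ Fintype.card α)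
    (by
      have h : (∅ : Finset (α ⊕ Option α)).toLeft = ∅ := by ext; simp
      simp [h])
    (fun I J hJ hIJ => ⟨(Finset.toLeft_subset_toLeft hIJ).trans hJ.1,
      hJ.2.1.subset (Finset.coe_subset.2 (Finset.toLeft_subset_toLeft hIJ)),
      (Finset.card_le_card hIJ).trans hJ.2.2⟩)
    (by
      intro I J hI hJ hIJ
      by_cases h : J.toRight ⊆ I.toRight
      · have h1 := Finset.card_toLeft_add_card_toRight (u := I)
        have h2 := Finset.card_toLeft_add_card_toRight (u := J)
        have h3 := Finset.card_le_card h
        obtain ⟨e, heJ, heI, h4⟩ := hI.2.1.exists_insert_indep hJ.2.1 (by omega)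
        refine ⟨Sum.inl e, by simpa using heJ, by simpa using heI, ?_, ?_, ?_⟩
        · rw [Finset.toLeft_insert_inl]
          exact Finset.insert_subset (hJ.1 heJ) hI.1
        · rwa [Finset.toLeft_insert_inl]
        · have := Finset.card_insert_le (Sum.inl e) I
          have := hJ.2.2
          omega
      · obtain ⟨d, hdJ, hdI⟩ := Finset.not_subset.1 h
        refine ⟨Sum.inr d, by simpa using hdJ, by simpa using hdI, ?_, ?_, ?_⟩
        · rw [Finset.toLeft_insert_inr]
          exact hI.1
        · rw [Finset.toLeft_insert_inr]
          exact hI.2.1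
        · have := Finset.card_insert_le (Sum.inr d) I
          have := hJ.2.2
          omega)
    (by simp)).matroid

theorem pad_indep_iff (M : Matroid α) (R : Finset α) (X : Finset (α ⊕ Option α)) :
    (M.pad R).Indep (X : Set (α ⊕ Option α)) ↔
      X.toLeft ⊆ R ∧ M.Indep (X.toLeft : Set α) ∧ X.card ≤ Fintype.card α := by
  simp only [pad, IndepMatroid.matroid_indep_iff, IndepMatroid.ofFinset_indep]

theorem pad_isBase_iff (M : Matroid α) (R : Finset α) (X : Finset (α ⊕ Option α)) :
    (M.pad R).IsBase (X : Set (α ⊕ Option α)) ↔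
      X.toLeft ⊆ R ∧ M.Indep (X.toLeft : Set α) ∧ X.card = Fintype.card α := by
  have hD : (M.pad R).IsBase
      (((Finset.univ : Finset α).map ⟨fun a => Sum.inr (some a), fun a b h => by simpa using h⟩ :
        Finset (α ⊕ Option α)) : Set (α ⊕ Option α)) := by
    set D : Finset (α ⊕ Option α) :=
      (Finset.univ : Finset α).map ⟨fun a => Sum.inr (some a), fun a b h => by simpa using h⟩
    have hDc : D.card = Fintype.card α := by simp [D]
    have hDl : D.toLeft = ∅ := by ext; simp [D]
    have hDi : (M.pad R).Indep (D : Set (α ⊕ Option α)) := by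
      rw [pad_indep_iff, hDl, hDc]; simp
    obtain ⟨B, hB⟩ := (M.pad R).exists_isBase_finset
    exact hDi.isBase_of_card_le hB (hDc ▸ ((pad_indep_iff M R B).1 hB.indep).2.2)
  constructor
  · intro h
    obtain ⟨h1, h2, h3⟩ := (pad_indep_iff M R X).1 h.indep
    exact ⟨h1, h2, by rw [h.card_eq_card hD]; simp⟩
  · rintro ⟨h1, h2, h3⟩
    exact ((pad_indep_iff M R X).2 ⟨h1, h2, h3.le⟩).isBase_of_card_le hD (by simp [h3])

theorem exists_common_isBase_pad (M N : Matroid α) (R : Finset α) :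
    ∃ B : Finset (α ⊕ Option α), (M.pad R).IsBase (B : Set (α ⊕ Option α)) ∧
      (N.pad R).IsBase (B : Set (α ⊕ Option α)) := by
  refine ⟨(Finset.univ : Finset α).map ⟨fun a => Sum.inr (some a), fun a b h => by simpa using h⟩,
    ?_⟩
  have hDl : ((Finset.univ : Finset α).map
    ⟨fun a => (Sum.inr (some a) : α ⊕ Option α), fun a b h => by simpa using h⟩).toLeft = ∅ := by
    ext; simp
  rw [pad_isBase_iff, pad_isBase_iff, hDl]
  simp

/-- A base of maximum weight contains as many elements of weight above a threshold as any
independent set. -/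
theorem IsMaxBase.card_filter_le {M : Matroid α} {u : α → ℤ} {B X : Finset α}
    (hB : M.IsMaxBase u B) (hX : M.Indep (X : Set α)) (j : ℤ) (hXj : ∀ x ∈ X, j < u x) :
    X.card ≤ (B.filter fun x => j < u x).card := by
  by_contra! h
  have hBj : M.Indep ((B.filter fun x => j < u x : Finset α) : Set α) :=
    hB.1.indep.subset (Finset.coe_subset.2 (Finset.filter_subset _ _))
  obtain ⟨e, heX, heB, he⟩ := hBj.exists_insert_indep hX h
  have heB' : e ∉ B := fun h => heB (Finset.mem_filter.2 ⟨h, hXj e heX⟩)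
  obtain ⟨B', hB', h1, h2⟩ := he.exists_isBase_subset_union_isBase hB.1
  lift B' to Finset α using Set.toFinite B'
  rw [Finset.coe_subset] at h1
  rw [← Finset.coe_union, Finset.coe_subset] at h2
  have hd : B' \ B = {e} := by
    ext x
    have := h1 (Finset.mem_insert_self e _)
    have := @h2 x
    grind
  have hc : (B \ B').card = 1 := by
    rw [Finset.card_sdiff_comm (hB.1.card_eq_card hB'), hd, Finset.card_singleton]
  obtain ⟨f, hf⟩ := Finset.card_eq_one.1 hc
  have hff : f ∈ B ∧ f ∉ B' := by rw [← Finset.mem_sdiff, hf]; simp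
  have hfj : u f ≤ j := by
    by_contra! hlt
    exact hff.2 (h1 (Finset.mem_insert_of_mem (Finset.mem_filter.2 ⟨hff.1, hlt⟩)))
  have h3 := Finset.sum_sdiff_sub_sum_sdiff (s₁ := B) (s₂ := B') (f := u)
  rw [hd, hf, Finset.sum_singleton, Finset.sum_singleton] at h3
  have h4 := hB.2 B' hB'
  have h5 := hXj e heX
  linarith

/-- Layer-cake counting: an element `x` of the base lies in at most `u x` of the superlevel sets `j
< u x`, and each such set within `B` is at least as large as `X j`. -/
theorem IsMaxBase.sum_card_le {M : Matroid α} {u : α → ℤ} {B : Finset α}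
    (hB : M.IsMaxBase u B) (hu : ∀ x ∈ B, 0 ≤ u x) (m : ℕ) (X : ℕ → Finset α)
    (hX : ∀ j, M.Indep (X j : Set α)) (hXj : ∀ j, ∀ x ∈ X j, (j : ℤ) < u x) :
    (∑ j ∈ Finset.range m, ((X j).card : ℤ)) ≤ ∑ x ∈ B, u x := by
  calc (∑ j ∈ Finset.range m, ((X j).card : ℤ))
      ≤ ∑ j ∈ Finset.range m, ((B.filter fun x => (j : ℤ) < u x).card : ℤ) := by
        refine Finset.sum_le_sum fun j _ => ?_
        exact_mod_cast hB.card_filter_le (hX j) j (hXj j)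
    _ = ∑ x ∈ B, (((Finset.range m).filter fun j : ℕ => (j : ℤ) < u x).card : ℤ) := by
        simp only [Finset.card_filter, Nat.cast_sum]
        exact Finset.sum_comm
    _ ≤ ∑ x ∈ B, u x := by
        refine Finset.sum_le_sum fun x hx => ?_
        have h : ((Finset.range m).filter fun j : ℕ => (j : ℤ) < u x) ⊆
            Finset.range (u x).toNat := by
          intro j hj
          have := (Finset.mem_filter.1 hj).2
          rw [Finset.mem_range]
          omega
        have h' := Finset.card_le_card h
        rw [Finset.card_range] at h'
        have := hu x hx
        omega

/-- Every family of copies `(e, j, k)`, where `j + k + 1` is the weight of `e`, whose layers for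
fixed `j` are independent in `M` and whose layers for fixed `k` are independent in `N`, contains the
elements of a common independent set whose weight is at least the number of copies. -/
theorem exists_commonIndep_card_le_weight (M N : Matroid α) (w : α → ℕ)
    (S : Finset (α × ℕ × ℕ)) (hw : ∀ s ∈ S, s.2.1 + s.2.2 + 1 = w s.1)
    (hM : ∀ j, M.Indep (((S.filter fun s => s.2.1 = j).image Prod.fst : Finset α) : Set α))
    (hN : ∀ k, N.Indep (((S.filter fun s => s.2.2 = k).image Prod.fst : Finset α) : Set α)) :
    ∃ I ⊆ S.image Prod.fst, M.Indep (I : Set α) ∧ N.Indep (I : Set α) ∧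
      S.card ≤ ∑ e ∈ I, w e := by
  set R := S.image Prod.fst with hR
  obtain ⟨u', v', B, huv', hu', hv'⟩ := exists_weight_splitting (M.pad R) (N.pad R)
    (Sum.elim (fun e => (w e : ℤ)) fun _ => 0) (exists_common_isBase_pad M N R)
  have hBM := (pad_isBase_iff M R B).1 hu'.1
  have hBN := (pad_isBase_iff N R B).1 hv'.1
  -- There is one more dummy than a base has elements, hence a spare one. Normalizing its split
  -- weights to zero makes both splits nonnegative on `B`, because any element may be exchanged for
  -- it.
  obtain ⟨d, hd⟩ : ∃ d : Option α, Sum.inr d ∉ B := by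
    by_contra! h
    have h1 : (Finset.univ : Finset (Option α)) ⊆ B.toRight := fun d _ => by simpa using h d
    have h2 := Finset.card_le_card h1
    have h3 := Finset.card_toLeft_add_card_toRight (u := B)
    rw [Finset.card_univ, Fintype.card_option] at h2
    omega
  set u : α ⊕ Option α → ℤ := fun x => u' x - u' (Sum.inr d) with hu_def
  set v : α ⊕ Option α → ℤ := fun x => v' x - v' (Sum.inr d) with hv_def
  have hu : (M.pad R).IsMaxBase u B := hu'.sub_const _
  have hv : (N.pad R).IsMaxBase v B := hv'.sub_const _
  have huv : ∀ x, u x + v x = Sum.elim (fun e => (w e : ℤ)) (fun _ => 0) x := by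
    intro x
    have h1 := huv' x
    have h2 := huv' (Sum.inr d)
    simp only [hu_def, hv_def, Sum.elim_inr] at h1 h2 ⊢
    linarith
  have nonneg : ∀ (K : Matroid α) (f : α ⊕ Option α → ℤ), (K.pad R).IsMaxBase f B →
      f (Sum.inr d) = 0 → ∀ x ∈ B, 0 ≤ f x := by
    intro K f hf hfd x hx
    have h1 := (pad_isBase_iff K R B).1 hf.1
    have h2 : (K.pad R).IsBase ((insert (Sum.inr d) (B.erase x) : Finset (α ⊕ Option α)) :
        Set (α ⊕ Option α)) := by
      have h3 : (insert (Sum.inr d) (B.erase x)).toLeft ⊆ B.toLeft := by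
        intro y hy
        simp at hy ⊢
        exact hy.2
      rw [pad_isBase_iff]
      refine ⟨h3.trans h1.1, h1.2.1.subset (Finset.coe_subset.2 h3), ?_⟩
      rw [Finset.card_insert_of_notMem (fun h => hd (Finset.mem_of_mem_erase h)),
        Finset.card_erase_of_mem hx, ← h1.2.2]
      have := Finset.card_pos.2 ⟨x, hx⟩
      omega
    have h4 := hf.2 _ h2
    rw [sum_insert_erase f hx hd, hfd] at h4
    linarith
  have hu0 := nonneg M u hu (by simp [hu_def])
  have hv0 := nonneg N v hv (by simp [hv_def])
  refine ⟨B.toLeft, hBM.1, hBM.2.1, hBN.2.1, ?_⟩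
  have hsum : ∑ x ∈ B, u x + ∑ x ∈ B, v x = ∑ e ∈ B.toLeft, (w e : ℤ) := by
    rw [← Finset.sum_add_distrib, Finset.sum_congr rfl fun x _ => huv x,
      ← Finset.toLeft_disjSum_toRight (u := B), Finset.sum_disjSum]
    simp
  obtain ⟨m, hm⟩ : ∃ m : ℕ, ∀ s ∈ S, s.2.1 < m ∧ s.2.2 < m := by
    refine ⟨S.sup (fun s => s.2.1 + s.2.2 + 1), fun s hs => ?_⟩
    have := Finset.le_sup (f := fun s : α × ℕ × ℕ => s.2.1 + s.2.2 + 1) hs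
    omega
  have layer : ∀ (K : Matroid α) (f : α ⊕ Option α → ℤ) (π : ℕ × ℕ → ℕ),
      (K.pad R).IsMaxBase f B → (∀ x ∈ B, 0 ≤ f x) → (∀ s ∈ S, π s.2 < m) →
      -- Within one layer distinct copies belong to distinct elements: the weight of the element and
      -- one coordinate determine the other.
      (∀ s ∈ S, ∀ s' ∈ S, s.1 = s'.1 → π s.2 = π s'.2 → s = s') →
      (∀ j, K.Indep (((S.filter fun s => π s.2 = j).image Prod.fst : Finset α) : Set α)) →
      ((S.filter fun s => (π s.2 : ℤ) < f (Sum.inl s.1)).card : ℤ) ≤ ∑ x ∈ B, f x := by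
    intro K f π hf hf0 hπ hinj hK
    set X : ℕ → Finset (α ⊕ Option α) := fun j =>
      (S.filter fun s => π s.2 = j ∧ (j : ℤ) < f (Sum.inl s.1)).image fun s => Sum.inl s.1
    have hXl : ∀ j, (X j).toLeft ⊆ (S.filter fun s => π s.2 = j).image Prod.fst := by
      intro j e he
      simp only [X, Finset.mem_toLeft, Finset.mem_image, Finset.mem_filter, Sum.inl.injEq] at he ⊢
      obtain ⟨s, hs, rfl⟩ := he
      exact ⟨s, ⟨hs.1, hs.2.1⟩, rfl⟩
    have h1 := hf.sum_card_le hf0 m X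
      (by
        intro j
        have hr : (X j).toRight = ∅ := by ext; simp [X]
        rw [pad_indep_iff]
        refine ⟨(hXl j).trans (Finset.image_subset_image (Finset.filter_subset _ _)),
          (hK j).subset (Finset.coe_subset.2 (hXl j)), ?_⟩
        rw [← Finset.card_toLeft_add_card_toRight, hr, Finset.card_empty, add_zero]
        exact Finset.card_le_univ _)
      (by
        intro j x hx
        simp only [X, Finset.mem_image, Finset.mem_filter] at hx
        obtain ⟨s, hs, rfl⟩ := hx
        exact hs.2.2)
    refine le_trans (le_of_eq ?_) h1
    rw [Finset.card_eq_sum_card_fiberwise (f := fun s => π s.2) (t := Finset.range m)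
      (fun s hs => by
        simp only [Finset.coe_filter, Set.mem_ofPred_eq] at hs
        simpa using hπ s hs.1)]
    push_cast
    refine Finset.sum_congr rfl fun j _ => ?_
    have h2 : (S.filter fun s => (π s.2 : ℤ) < f (Sum.inl s.1)).filter (fun s => π s.2 = j) =
        S.filter fun s => π s.2 = j ∧ (j : ℤ) < f (Sum.inl s.1) := by
      ext s; simp only [Finset.mem_filter]; grind
    rw [h2, Finset.card_image_of_injOn]
    intro s hs s' hs' hss
    simp only [Finset.coe_filter, Set.mem_ofPred_eq] at hs hs'
    exact hinj s hs.1 s' hs'.1 (by simpa using hss) (hs.2.1.trans hs'.2.1.symm)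
  have hA := layer M u Prod.fst hu hu0 (fun s hs => (hm s hs).1)
    (by
      intro s hs s' hs' h1 h2
      have := hw s hs
      have := hw s' hs'
      refine Prod.ext h1 (Prod.ext h2 ?_)
      rw [h1] at *
      omega) hM
  have hB := layer N v Prod.snd hv hv0 (fun s hs => (hm s hs).2)
    (by
      intro s hs s' hs' h1 h2
      have := hw s hs
      have := hw s' hs'
      refine Prod.ext h1 (Prod.ext ?_ h2)
      rw [h1] at *
      omega) hN
  -- If both inequalities failed, `j + k` would be at least `u e + v e = w e = j + k + 1`.
  have hcov : S ⊆ (S.filter fun s => (s.2.1 : ℤ) < u (Sum.inl s.1)) ∪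
      (S.filter fun s => (s.2.2 : ℤ) < v (Sum.inl s.1)) := by
    intro s hs
    have h1 := huv (Sum.inl s.1)
    have h2 := hw s hs
    simp only [Sum.elim_inl] at h1
    rw [Finset.mem_union, Finset.mem_filter, Finset.mem_filter]
    by_contra! h
    have := h.1 hs
    have := h.2 hs
    omega
  have h1 := (Finset.card_le_card hcov).trans (Finset.card_union_le _ _)
  zify
  zify at h1
  linarith

/-- A common independent set can be extended by all but `2 * I.card` elements of another one. -/
theorem exists_commonIndep_union (M N : Matroid α) {I J : Finset α}
    (hMI : M.Indep (I : Set α)) (hNI : N.Indep (I : Set α))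
    (hMJ : M.Indep (J : Set α)) (hNJ : N.Indep (J : Set α)) :
    ∃ D ⊆ J, M.Indep ((I ∪ D : Finset α) : Set α) ∧ N.Indep ((I ∪ D : Finset α) : Set α) ∧
      (J \ D).card ≤ 2 * I.card := by
  have one : ∀ K : Matroid α, K.Indep (I : Set α) → K.Indep (J : Set α) →
      ∃ D ⊆ J, K.Indep ((I ∪ D : Finset α) : Set α) ∧ (J \ D).card ≤ I.card := by
    intro K hI hJ
    obtain ⟨L, hIL, hL, hLi, hLc⟩ := hI.exists_card_eq_finRank (X := I ∪ J)
      Finset.subset_union_left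
    have h1 := hJ.card_le_finRank (X := I ∪ J) Finset.subset_union_right
    refine ⟨L ∩ J, Finset.inter_subset_right, ?_, ?_⟩
    · have : I ∪ L ∩ J = L := by ext x; have := @hIL x; have := @hL x; grind
      rwa [this]
    · have h2 : (J \ (L ∩ J)).card + (L ∩ J).card = J.card :=
        Finset.card_sdiff_add_card_eq_card Finset.inter_subset_right
      have h3 : L ⊆ I ∪ (L ∩ J) := by intro x hx; have := hL hx; grind
      have h4 := (Finset.card_le_card h3).trans (Finset.card_union_le _ _)
      omega
  obtain ⟨D₁, hD₁, h1, h2⟩ := one M hMI hMJ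
  obtain ⟨D₂, hD₂, h3, h4⟩ := one N hNI hNJ
  refine ⟨D₁ ∩ D₂, Finset.inter_subset_left.trans hD₁, h1.subset ?_, h3.subset ?_, ?_⟩
  · exact Finset.coe_subset.2 (Finset.union_subset_union_right Finset.inter_subset_left)
  · exact Finset.coe_subset.2 (Finset.union_subset_union_right Finset.inter_subset_right)
  · have h5 : J \ (D₁ ∩ D₂) ⊆ (J \ D₁) ∪ (J \ D₂) := by intro x; grind
    have := (Finset.card_le_card h5).trans (Finset.card_union_le _ _)
    omega

end Matroid

/-! ### Merging solutions of separated weight classes -/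

namespace Matroid

/-- Common independent sets whose weights are separated can be merged with a small loss. -/
theorem exists_commonIndep_of_finset_biUnion {α : Type*} [Fintype α] [DecidableEq α]
    (M N : Matroid α) (w : α → ℝ) {b : ℝ} (hb : 0 < b) (U : ℤ → ℝ) (I : ℤ → Finset α)
    (G : Finset ℤ) (hM : ∀ q ∈ G, M.Indep (I q : Set α)) (hN : ∀ q ∈ G, N.Indep (I q : Set α))
    (hw : ∀ q ∈ G, ∀ e ∈ I q, 0 ≤ w e ∧ w e ≤ U q) (hU : ∀ q ∈ G, 0 ≤ U q)
    (hUU : ∀ q ∈ G, ∀ q' ∈ G, q < q' → 2 * U q ≤ U q')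
    (hUw : ∀ q ∈ G, ∀ q' ∈ G, q < q' → ∀ e ∈ I q', b * U q ≤ w e)
    (hdisj : ∀ q ∈ G, ∀ q' ∈ G, q < q' → Disjoint (I q) (I q')) :
    ∃ J ⊆ G.biUnion I, M.Indep (J : Set α) ∧ N.Indep (J : Set α) ∧
      ∑ q ∈ G, ∑ e ∈ I q, w e ≤ (1 + 4 / b) * ∑ e ∈ J, w e := by
  -- Adding lighter classes one at a time discards at most `2 * J.card` elements of each. The extra
  -- term `4 * J.card * y` reserves room for this loss when `y` bounds the next class: as bounds at
  -- least halve from class to class, twice the current loss pays for all later ones. At the end `y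
  -- = 0`.
  suffices h : ∃ J ⊆ G.biUnion I, M.Indep (J : Set α) ∧ N.Indep (J : Set α) ∧
      ∀ y : ℝ, 0 ≤ y → (∀ q ∈ G, 2 * y ≤ U q) → (∀ q ∈ G, ∀ e ∈ I q, b * y ≤ w e) →
      ∑ q ∈ G, ∑ e ∈ I q, w e + 4 * J.card * y ≤ (1 + 4 / b) * ∑ e ∈ J, w e by
    obtain ⟨J, h1, h2, h3, h4⟩ := h
    refine ⟨J, h1, h2, h3, ?_⟩
    have := h4 0 le_rfl (by simpa using hU) (by simpa using fun q hq e he => (hw q hq e he).1)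
    simpa using this
  induction G using Finset.induction_on_min with
  | empty => exact ⟨∅, by simp⟩
  | insert a G ha ih =>
    have haG : a ∈ insert a G := Finset.mem_insert_self a G
    have hG : ∀ q ∈ G, q ∈ insert a G := fun q hq => Finset.mem_insert_of_mem hq
    have haG' : a ∉ G := fun h => lt_irrefl _ (ha a h)
    obtain ⟨J, hJ, hMJ, hNJ, h⟩ := ih (fun q hq => hM q (hG q hq)) (fun q hq => hN q (hG q hq))
      (fun q hq => hw q (hG q hq)) (fun q hq => hU q (hG q hq))
      (fun q hq q' hq' => hUU q (hG q hq) q' (hG q' hq'))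
      (fun q hq q' hq' => hUw q (hG q hq) q' (hG q' hq'))
      (fun q hq q' hq' => hdisj q (hG q hq) q' (hG q' hq'))
    obtain ⟨D, hD, hMD, hND, hc⟩ := exists_commonIndep_union M N hMJ hNJ (hM a haG) (hN a haG)
    refine ⟨J ∪ D, ?_, hMD, hND, ?_⟩
    · rw [Finset.biUnion_insert]
      exact Finset.union_subset (hJ.trans Finset.subset_union_right)
        (hD.trans Finset.subset_union_left)
    intro y hy hyU hyw
    have h1 := h (U a) (hU a haG) (fun q hq => hUU a haG q (hG q hq) (ha q hq))
      (fun q hq => hUw a haG q (hG q hq) (ha q hq))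
    have hJD : Disjoint J D := by
      rw [Finset.disjoint_left]
      intro x hx hxD
      obtain ⟨q, hq, hxq⟩ := Finset.mem_biUnion.1 (hJ hx)
      exact Finset.disjoint_left.1 (hdisj a haG q (hG q hq) (ha q hq)) (hD hxD) hxq
    rw [Finset.sum_insert haG', Finset.sum_union hJD, Finset.card_union_of_disjoint hJD]
    have h2 : ∑ e ∈ I a, w e ≤ ∑ e ∈ D, w e + 2 * J.card * U a := by
      rw [← Finset.sum_sdiff hD, add_comm]
      have h3 : ∑ e ∈ I a \ D, w e ≤ (I a \ D).card * U a := by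
        rw [← nsmul_eq_mul]
        exact Finset.sum_le_card_nsmul _ _ _ fun e he =>
          (hw a haG e (Finset.sdiff_subset he)).2
      have h4 : ((I a \ D).card : ℝ) ≤ 2 * J.card := by exact_mod_cast hc
      have := mul_le_mul_of_nonneg_right h4 (hU a haG)
      linarith
    have h5 : (D.card : ℝ) * y ≤ (∑ e ∈ D, w e) / b := by
      rw [le_div_iff₀ hb]
      have : D.card • (b * y) ≤ ∑ e ∈ D, w e :=
        Finset.card_nsmul_le_sum _ _ _ fun e he => hyw a haG e (hD he)
      rw [nsmul_eq_mul] at this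
      linarith
    have h6 := mul_le_mul_of_nonneg_left (hyU a haG) (Nat.cast_nonneg (α := ℝ) J.card)
    have h7 : (1 + 4 / b) * ∑ e ∈ D, w e = ∑ e ∈ D, w e + 4 * ((∑ e ∈ D, w e) / b) := by ring
    push_cast
    rw [mul_add (1 + 4 / b), h7]
    linarith

end Matroid

/-! ### Unfolding integral weights into copies -/

namespace MatroidPair

variable {n : ℕ}

/-- The element of which `x` is a copy. -/
def copyElt (γ : ℕ) (x : Fin (γ * n)) : Fin n := (finProdFinEquiv.symm x).2

/-- The layers in the first and in the second matroid of the copy `x`. -/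
def copyLayers (γ : ℕ) (x : Fin (γ * n)) : ℕ × ℕ := Nat.unpair (finProdFinEquiv.symm x).1

/-- The weight of the elements for which the copy `x` is used. -/
def copyWeight (γ : ℕ) (x : Fin (γ * n)) : ℕ := (copyLayers γ x).1 + (copyLayers γ x).2 + 1

theorem copy_ext {γ : ℕ} {x y : Fin (γ * n)} (h : copyElt γ x = copyElt γ y)
    (h' : copyLayers γ x = copyLayers γ y) : x = y := by
  apply finProdFinEquiv.symm.injective
  refine Prod.ext (Fin.ext ?_) h
  have := congrArg (Function.uncurry Nat.pair) h'
  simpa [copyLayers, Function.uncurry] using this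

theorem exists_copy {γ : ℕ} (e : Fin n) (j k : ℕ) (h : (j + k + 1) ^ 2 ≤ γ) :
    ∃ x : Fin (γ * n), copyElt γ x = e ∧ copyLayers γ x = (j, k) := by
  have h1 : Nat.pair j k < γ := by
    refine (Nat.pair_lt_max_add_one_sq j k).trans_le (le_trans ?_ h)
    exact Nat.pow_le_pow_left (by omega) 2
  refine ⟨finProdFinEquiv (⟨Nat.pair j k, h1⟩, e), ?_, ?_⟩ <;> simp [copyElt, copyLayers]

/-- The layered matroid on the copies, where `π` selects the layer of a copy. -/
def unfoldMatroid (γ : ℕ) (π : ℕ × ℕ → ℕ) (M : Matroid (Fin n)) : Matroid (Fin (γ * n)) :=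
  (Matroid.sum' fun _ : ℕ => M).comap fun x => (π (copyLayers γ x), copyElt γ x)

theorem unfoldMatroid_indep_iff (γ : ℕ) (π : ℕ × ℕ → ℕ) (M : Matroid (Fin n))
    (S : Finset (Fin (γ * n))) :
    (unfoldMatroid γ π M).Indep (S : Set (Fin (γ * n))) ↔
      (∀ j, M.Indep (((S.filter fun x => π (copyLayers γ x) = j).image (copyElt γ) :
        Finset (Fin n)) : Set (Fin n))) ∧
      Set.InjOn (fun x => (π (copyLayers γ x), copyElt γ x)) (S : Set (Fin (γ * n))) := by
  rw [unfoldMatroid, Matroid.comap_indep_iff, Matroid.sum'_indep_iff]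
  have : ∀ j, Prod.mk j ⁻¹' ((fun x => (π (copyLayers γ x), copyElt γ x)) '' (S : Set _)) =
      (((S.filter fun x => π (copyLayers γ x) = j).image (copyElt γ) : Finset (Fin n)) :
        Set (Fin n)) := by
    intro j
    ext e
    simp [and_assoc]
  simp only [this]

/-- The matroid pair on the copies of the elements: the layers of the first matroid are given by the
first components, the layers of the second matroid by the second components. -/
def unfold (M : MatroidPair n) (γ : ℕ) : MatroidPair (γ * n) where
  M₁ := unfoldMatroid γ Prod.fst M.M₁
  M₂ := unfoldMatroid γ Prod.snd M.M₂
  ground₁ := by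
    ext x
    simp [unfoldMatroid, M.ground₁]
  ground₂ := by
    ext x
    simp [unfoldMatroid, M.ground₂]

/-- The copies which stand for the elements of `A` with the integral weights `v`. -/
def copies (γ : ℕ) (A : Finset (Fin n)) (v : Fin n → ℕ) : Finset (Fin (γ * n)) :=
  Finset.univ.filter fun x => copyElt γ x ∈ A ∧ copyWeight γ x = v (copyElt γ x)

theorem mem_copies {γ : ℕ} {A : Finset (Fin n)} {v : Fin n → ℕ} {x : Fin (γ * n)} :
    x ∈ copies γ A v ↔ copyElt γ x ∈ A ∧ copyWeight γ x = v (copyElt γ x) := by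
  simp [copies]

/-- Each layer projects into `T`, and no element repeats within a layer because its weight and one
coordinate fix the copy. -/
theorem commonIndep_copies (M : MatroidPair n) (γ : ℕ) {E T : Finset (Fin n)}
    (hT : M.CommonIndep E T) (v : Fin n → ℕ) :
    (M.unfold γ).CommonIndep (copies γ E v) (copies γ T v) := by
  have hsub : ∀ π : ℕ × ℕ → ℕ, ∀ j,
      ((copies γ T v).filter fun x => π (copyLayers γ x) = j).image (copyElt γ) ⊆ T := by
    intro π j e he
    simp only [Finset.mem_image, Finset.mem_filter, mem_copies] at he
    obtain ⟨x, hx, rfl⟩ := he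
    exact hx.1.1
  refine ⟨?_, ?_, ?_⟩
  · intro x hx
    rw [mem_copies] at hx ⊢
    exact ⟨hT.1 hx.1, hx.2⟩
  all_goals
    refine (unfoldMatroid_indep_iff γ _ _ _).2 ⟨fun j => ?_, ?_⟩
  · exact hT.2.1.subset (Finset.coe_subset.2 (hsub _ j))
  · intro x hx y hy hxy
    rw [Finset.mem_coe, mem_copies] at hx hy
    rw [Prod.mk.injEq] at hxy
    have h1 := hx.2
    have h2 := hy.2
    rw [hxy.2, ← h2, copyWeight, copyWeight, hxy.1] at h1
    exact copy_ext hxy.2 (Prod.ext hxy.1 (by omega))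
  · exact hT.2.2.subset (Finset.coe_subset.2 (hsub _ j))
  · intro x hx y hy hxy
    rw [Finset.mem_coe, mem_copies] at hx hy
    rw [Prod.mk.injEq] at hxy
    have h1 := hx.2
    have h2 := hy.2
    rw [hxy.2, ← h2, copyWeight, copyWeight, hxy.1] at h1
    exact copy_ext hxy.2 (Prod.ext (by omega) hxy.1)

/-- An element of weight `v` has the copies `(j, v - 1 - j)` for `j < v`. The square bound
guarantees that the code `Nat.pair` of each of them is below `γ`. -/
theorem card_copies (γ : ℕ) (T : Finset (Fin n)) (v : Fin n → ℕ) (hv : ∀ e ∈ T, v e ^ 2 ≤ γ) :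
    (copies γ T v).card = ∑ e ∈ T, v e := by
  rw [Finset.card_eq_sum_card_fiberwise (f := copyElt γ) (t := T)
    (fun x hx => (mem_copies.1 hx).1)]
  refine Finset.sum_congr rfl fun e he => ?_
  rw [← Finset.card_range (v e)]
  refine Finset.card_bij (fun x _ => (copyLayers γ x).1) ?_ ?_ ?_
  · intro x hx
    rw [Finset.mem_filter, mem_copies] at hx
    have := hx.1.2
    rw [hx.2, copyWeight] at this
    rw [Finset.mem_range]
    omega
  · intro x hx y hy hxy
    rw [Finset.mem_filter, mem_copies] at hx hy
    have h1 := hx.1.2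
    have h2 := hy.1.2
    rw [hx.2, copyWeight] at h1
    rw [hy.2, copyWeight] at h2
    exact copy_ext (hx.2.trans hy.2.symm) (Prod.ext hxy (by omega))
  · intro j hj
    rw [Finset.mem_range] at hj
    have h1 : j + (v e - 1 - j) + 1 = v e := by omega
    obtain ⟨x, hx, hx'⟩ := exists_copy (γ := γ) e j (v e - 1 - j) (by rw [h1]; exact hv e he)
    refine ⟨x, ?_, by rw [hx']⟩
    rw [Finset.mem_filter, mem_copies, hx, copyWeight, hx']
    exact ⟨⟨he, h1⟩, rfl⟩

/-- Every common independent set of copies can be folded to a common independent set whose weight is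
at least the number of copies. -/
theorem exists_fold (M : MatroidPair n) (γ : ℕ) {E : Finset (Fin n)} {v : Fin n → ℕ}
    {S : Finset (Fin (γ * n))} (hS : (M.unfold γ).CommonIndep (copies γ E v) S) :
    ∃ I ⊆ S.image (copyElt γ), M.CommonIndep E I ∧ S.card ≤ ∑ e ∈ I, v e := by
  set S' : Finset (Fin n × ℕ × ℕ) := S.image fun x => (copyElt γ x, copyLayers γ x) with hS'
  have hlayer : ∀ (π : ℕ × ℕ → ℕ) j, (S'.filter fun s => π s.2 = j).image Prod.fst =
      (S.filter fun x => π (copyLayers γ x) = j).image (copyElt γ) := by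
    intro π j
    ext e
    simp only [hS', Finset.mem_image, Finset.mem_filter]
    constructor
    · rintro ⟨_, ⟨⟨x, hx, rfl⟩, h⟩, rfl⟩
      exact ⟨x, ⟨hx, h⟩, rfl⟩
    · rintro ⟨x, ⟨hx, h⟩, rfl⟩
      exact ⟨_, ⟨⟨x, hx, rfl⟩, h⟩, rfl⟩
  obtain ⟨I, hI, hI1, hI2, hI3⟩ := Matroid.exists_commonIndep_card_le_weight M.M₁ M.M₂ v S'
    (by
      intro s hs
      obtain ⟨x, hx, rfl⟩ := Finset.mem_image.1 hs
      exact (mem_copies.1 (hS.1 hx)).2)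
    (fun j => by
      rw [hlayer Prod.fst]
      exact ((unfoldMatroid_indep_iff γ _ _ _).1 hS.2.1).1 j)
    (fun j => by
      rw [hlayer Prod.snd]
      exact ((unfoldMatroid_indep_iff γ _ _ _).1 hS.2.2).1 j)
  have hIS : I ⊆ S.image (copyElt γ) := by
    refine hI.trans (le_of_eq ?_)
    rw [hS', Finset.image_image]
    rfl
  refine ⟨I, hIS, ⟨?_, hI1, hI2⟩, ?_⟩
  · intro e he
    obtain ⟨x, hx, rfl⟩ := Finset.mem_image.1 (hIS he)
    exact (mem_copies.1 (hS.1 hx)).1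
  · rwa [hS', Finset.card_image_of_injective] at hI3
    intro x y hxy
    rw [Prod.mk.injEq] at hxy
    exact copy_ext hxy.1 hxy.2

theorem CommonIndep.card_le_commonRank {M : MatroidPair n} {X S : Finset (Fin n)}
    (h : M.CommonIndep X S) : S.card ≤ M.commonRank X := by
  classical
  exact Finset.le_sup (f := Finset.card) (by simpa using ⟨h.1, h⟩)

theorem commonRank_le_iff {M : MatroidPair n} {X : Finset (Fin n)} {r : ℕ} :
    M.commonRank X ≤ r ↔ ∀ S, M.CommonIndep X S → S.card ≤ r := by
  classical
  refine ⟨fun h S hS => hS.card_le_commonRank.trans h, fun h => Finset.sup_le fun S hS => ?_⟩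
  exact h S (by simpa using (Finset.mem_filter.1 hS).2)

/-- Folding gives at most `r` elements, each of weight at most `γ`; this is why the rank argument of
the bit bound is multiplied by `γ`. -/
theorem commonRank_unfold_le (M : MatroidPair n) (γ : ℕ) (E : Finset (Fin n)) (v : Fin n → ℕ)
    (hv : ∀ e ∈ E, v e ≤ γ) {r : ℕ} (hr : M.commonRank E ≤ r) :
    (M.unfold γ).commonRank (copies γ E v) ≤ γ * r := by
  rw [commonRank_le_iff]
  intro S hS
  obtain ⟨I, -, hI, hIS⟩ := M.exists_fold γ hS
  calc S.card ≤ ∑ e ∈ I, v e := hIS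
    _ ≤ I.card • γ := Finset.sum_le_card_nsmul _ _ _ fun e he => hv e (hI.1 he)
    _ = γ * I.card := by rw [smul_eq_mul, mul_comm]
    _ ≤ γ * r := Nat.mul_le_mul_left _ (hI.card_le_commonRank.trans hr)

end MatroidPair

/-! ### Weight classes -/

/-- The number of powers of `b` between the scale of the slot `σ` and `x`. -/
noncomputable def slotOffset (b N σ : ℕ) (x : ℝ) : ℤ := (Int.log b x - σ) % N

/-- The exponent of the scale to which weights in the slot `σ` are rounded. -/
noncomputable def slotScale (b N σ : ℕ) (x : ℝ) : ℤ := Int.log b x - slotOffset b N σ x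

/-- The weight `x` in multiples of the scale of the slot `σ`, and zero if `x` is not in the slot. -/
noncomputable def slotWeight (b p N σ : ℕ) (x : ℝ) : ℕ :=
  if 1 ≤ slotOffset b N σ x ∧ slotOffset b N σ x < p then ⌊x / (b : ℝ) ^ slotScale b N σ x⌋₊ else 0

theorem dvd_slotScale_sub (b N σ : ℕ) (x : ℝ) : (N : ℤ) ∣ slotScale b N σ x - σ := by
  refine ⟨(Int.log b x - σ) / N, ?_⟩
  have := Int.emod_add_mul_ediv (Int.log b x - σ) N
  rw [slotScale, slotOffset]
  linarith

theorem le_and_lt_of_slotOffset {b p N σ : ℕ} {x : ℝ} (hb : 2 ≤ b) (hx : 0 < x)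
    (h : 1 ≤ slotOffset b N σ x ∧ slotOffset b N σ x < p) :
    (b : ℝ) ^ (slotScale b N σ x + 1) ≤ x ∧ x < (b : ℝ) ^ (slotScale b N σ x + p) := by
  have hb1 : (1 : ℝ) ≤ b := by exact_mod_cast (by omega : 1 ≤ b)
  constructor
  · refine le_trans (zpow_le_zpow_right₀ hb1 ?_) (Int.zpow_log_le_self (by omega) hx)
    rw [slotScale]
    linarith [h.1]
  · refine lt_of_lt_of_le (Int.lt_zpow_succ_log_self (b := b) (by omega) x)
      (zpow_le_zpow_right₀ hb1 ?_)
    rw [slotScale]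
    linarith [h.2]

theorem le_slotWeight_of_slotOffset {b p N σ : ℕ} {x : ℝ} (hb : 2 ≤ b) (hx : 0 < x)
    (h : 1 ≤ slotOffset b N σ x ∧ slotOffset b N σ x < p) : b ≤ slotWeight b p N σ x := by
  have hb0 : (0 : ℝ) < b := by exact_mod_cast (by omega : 0 < b)
  rw [slotWeight, if_pos h]
  refine Nat.le_floor ?_
  rw [le_div_iff₀ (zpow_pos hb0 _), mul_comm, ← zpow_add_one₀ hb0.ne']
  exact (le_and_lt_of_slotOffset hb hx h).1

/-- Excluding offset zero makes the rounded weight at least `b`, so dropping less than one unit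
costs only the relative error `1 / b`. -/
theorem slotWeight_spec {b p N σ : ℕ} {x : ℝ} (hb : 2 ≤ b) (hx : 0 < x)
    (h : slotWeight b p N σ x ≠ 0) :
    (b : ℝ) ^ (slotScale b N σ x + 1) ≤ x ∧ x < (b : ℝ) ^ (slotScale b N σ x + p) ∧
    (slotWeight b p N σ x : ℝ) * (b : ℝ) ^ slotScale b N σ x ≤ x ∧
    x ≤ (1 + 1 / b) * (slotWeight b p N σ x * (b : ℝ) ^ slotScale b N σ x) := by
  have hb0 : (0 : ℝ) < b := by exact_mod_cast (by omega : 0 < b)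
  have hs : (0 : ℝ) < (b : ℝ) ^ slotScale b N σ x := zpow_pos hb0 _
  have h' : 1 ≤ slotOffset b N σ x ∧ slotOffset b N σ x < p := by
    by_contra hn
    exact h (if_neg hn)
  have h1 := le_and_lt_of_slotOffset hb hx h'
  have h2 : (b : ℝ) ≤ slotWeight b p N σ x := by
    exact_mod_cast le_slotWeight_of_slotOffset hb hx h'
  refine ⟨h1.1, h1.2, ?_, ?_⟩
  · rw [← le_div_iff₀ hs, slotWeight, if_pos h']
    exact Nat.floor_le (by positivity)
  · have h3 : x < (slotWeight b p N σ x + 1) * (b : ℝ) ^ slotScale b N σ x := by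
      rw [← div_lt_iff₀ hs, slotWeight, if_pos h']
      exact Nat.lt_floor_add_one _
    refine h3.le.trans ?_
    rw [← mul_assoc]
    refine mul_le_mul_of_nonneg_right ?_ hs.le
    rw [add_mul, one_mul, div_mul_eq_mul_div, one_mul]
    linarith [(one_le_div hb0).2 h2]

theorem slotWeight_lt {b p N σ : ℕ} {x : ℝ} (hb : 2 ≤ b) (hx : 0 < x) :
    slotWeight b p N σ x < b ^ p := by
  have hb0 : (0 : ℝ) < b := by exact_mod_cast (by omega : 0 < b)
  by_cases h : slotWeight b p N σ x = 0
  · rw [h]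
    exact pow_pos (by omega) p
  obtain ⟨-, h1, h2, -⟩ := slotWeight_spec hb hx h
  have h3 := h2.trans_lt h1
  rw [add_comm, zpow_add₀ hb0.ne', zpow_natCast] at h3
  exact_mod_cast lt_of_mul_lt_mul_right h3 (zpow_pos hb0 _).le

/-- Weights that look alike in a slot agree up to rounding and a power of `b ^ N`. -/
theorem exists_scaling_of_slotWeight_eq {b p N σ : ℕ} {x y : ℝ} (hb : 2 ≤ b) (hx : 0 < x)
    (hy : 0 < y) (h : slotWeight b p N σ x ≠ 0)
    (hxy : slotWeight b p N σ y = slotWeight b p N σ x) :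
    ∃ t : ℤ, y ≤ (1 + 1 / b) * ((b : ℝ) ^ (N * t) * x) ∧ (b : ℝ) ^ (N * t) * x ≤ (1 + 1 / b) * y := by
  have hb0 : (0 : ℝ) < b := by exact_mod_cast (by omega : 0 < b)
  obtain ⟨t, ht⟩ : (N : ℤ) ∣ slotScale b N σ y - slotScale b N σ x := by
    have := dvd_sub (dvd_slotScale_sub b N σ y) (dvd_slotScale_sub b N σ x)
    rwa [sub_sub_sub_cancel_right] at this
  obtain ⟨-, -, h1, h2⟩ := slotWeight_spec hb hx h
  obtain ⟨-, -, h3, h4⟩ := slotWeight_spec hb hy (hxy ▸ h)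
  have ht' : slotScale b N σ y = N * t + slotScale b N σ x := by linarith
  rw [hxy, ht', zpow_add₀ hb0.ne'] at h3 h4
  have hβ : 0 < (b : ℝ) ^ ((N : ℤ) * t) := zpow_pos hb0 _
  have hc : (0 : ℝ) < 1 + 1 / b := by positivity
  refine ⟨t, h4.trans (mul_le_mul_of_nonneg_left ?_ hc.le), ?_⟩
  · calc _ = (b : ℝ) ^ ((N : ℤ) * t) * (slotWeight b p N σ x * (b : ℝ) ^ slotScale b N σ x) := by ring
      _ ≤ _ := mul_le_mul_of_nonneg_left h1 hβ.le
  · calc _ ≤ (b : ℝ) ^ ((N : ℤ) * t) *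
          ((1 + 1 / b) * (slotWeight b p N σ x * (b : ℝ) ^ slotScale b N σ x)) :=
          mul_le_mul_of_nonneg_left h2 hβ.le
      _ = (1 + 1 / b) * (slotWeight b p N σ x *
          ((b : ℝ) ^ ((N : ℤ) * t) * (b : ℝ) ^ slotScale b N σ x)) := by ring
      _ ≤ _ := mul_le_mul_of_nonneg_left h3 hc.le

theorem HasAspectRatio.mono {n : ℕ} {X Y : Finset (Fin n)} {w : Fin n → ℝ} {W : ℝ}
    (h : HasAspectRatio Y w W) (hXY : X ⊆ Y) : HasAspectRatio X w W :=
  ⟨fun e he => h.1 e (hXY he), fun e he f hf => h.2 e (hXY he) f (hXY hf)⟩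

/-- Two weight functions that look alike in the slots order the weights of sets alike, up to a
constant factor. -/
theorem sum_le_of_slotWeight_eq {n b p N : ℕ} {W : ℝ} (hb : 2 ≤ b) (hW : 1 ≤ W)
    (hN : 4 * W ^ 2 < (b : ℝ) ^ N) {R : Finset (Fin n)} {w w' : Fin n → ℝ}
    (hw : HasAspectRatio R w W) (hw' : HasAspectRatio R w' W)
    (h : ∀ e ∈ R, ∃ σ, slotWeight b p N σ (w e) ≠ 0 ∧
      slotWeight b p N σ (w' e) = slotWeight b p N σ (w e))
    {I Z : Finset (Fin n)} (hI : I ⊆ R) (hZ : Z ⊆ R) (hIZ : ∑ e ∈ I, w' e ≤ ∑ e ∈ Z, w' e) :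
    ∑ e ∈ I, w e ≤ (1 + 1 / b) ^ 2 * ∑ e ∈ Z, w e := by
  have hb0 : (0 : ℝ) < b := by exact_mod_cast (by omega : 0 < b)
  have hb1 : (1 : ℝ) ≤ b := by exact_mod_cast (by omega : 1 ≤ b)
  have hc : (0 : ℝ) < 1 + 1 / b := by positivity
  have hc2 : (1 + 1 / b : ℝ) ^ 2 ≤ 4 := by
    have : (1 / b : ℝ) ≤ 1 := (div_le_one hb0).2 hb1
    nlinarith
  have ht : ∀ e : Fin n, ∃ t : ℤ, e ∈ R → w' e ≤ (1 + 1 / b) * ((b : ℝ) ^ (N * t) * w e) ∧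
      (b : ℝ) ^ (N * t) * w e ≤ (1 + 1 / b) * w' e := by
    intro e
    by_cases he : e ∈ R
    · obtain ⟨σ, h1, h2⟩ := h e he
      obtain ⟨t, ht⟩ := exists_scaling_of_slotWeight_eq hb (hw.1 e he) (hw'.1 e he) h1 h2
      exact ⟨t, fun _ => ht⟩
    · exact ⟨0, fun h => absurd h he⟩
  choose t ht using ht
  -- All shifts agree: if two differed, the ratio of some two weights would change by at least `b ^
  -- N`, whereas both weight functions have aspect ratio at most `W` and rounding contributes at
  -- most `4`, contradicting `4 * W ^ 2 < b ^ N`.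
  have hle : ∀ e ∈ R, ∀ f ∈ R, t f ≤ t e := by
    intro e he f hf
    by_contra! hlt
    have h1 := (ht f hf).2
    have h2 := (ht e he).1
    have hβ : 0 < (b : ℝ) ^ ((N : ℤ) * t e) := zpow_pos hb0 _
    have hwf := hw.1 f hf
    have h4 : (b : ℝ) ^ ((N : ℤ) * t e) * (b : ℝ) ^ N ≤ (b : ℝ) ^ ((N : ℤ) * t f) := by
      rw [← zpow_natCast, ← zpow_add₀ hb0.ne']
      refine zpow_le_zpow_right₀ hb1 ?_
      have : (N : ℤ) * (t e + 1) ≤ N * t f := mul_le_mul_of_nonneg_left hlt (by positivity)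
      linarith
    have h5 : (b : ℝ) ^ ((N : ℤ) * t f) * w f ≤
        (b : ℝ) ^ ((N : ℤ) * t e) * ((1 + 1 / b) ^ 2 * W ^ 2) * w f := by
      calc (b : ℝ) ^ ((N : ℤ) * t f) * w f ≤ (1 + 1 / b) * w' f := h1
        _ ≤ (1 + 1 / b) * (W * w' e) := mul_le_mul_of_nonneg_left (hw'.2 f hf e he) hc.le
        _ ≤ (1 + 1 / b) * (W * ((1 + 1 / b) * ((b : ℝ) ^ ((N : ℤ) * t e) * w e))) := by gcongr
        _ ≤ (1 + 1 / b) * (W * ((1 + 1 / b) * ((b : ℝ) ^ ((N : ℤ) * t e) * (W * w f)))) := by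
          gcongr
          exact hw.2 e he f hf
        _ = _ := by ring
    have h6 := h4.trans (le_of_mul_le_mul_right h5 hwf)
    have h7 := le_of_mul_le_mul_left h6 hβ
    have h8 : (1 + 1 / b : ℝ) ^ 2 * W ^ 2 ≤ 4 * W ^ 2 :=
      mul_le_mul_of_nonneg_right hc2 (by positivity)
    linarith
  rcases R.eq_empty_or_nonempty with hR | ⟨f, hf⟩
  · rw [hR, Finset.subset_empty] at hI hZ
    simp [hI, hZ]
  have hβ : 0 < (b : ℝ) ^ ((N : ℤ) * t f) := zpow_pos hb0 _
  have hteq : ∀ e ∈ R, t e = t f := fun e he => le_antisymm (hle f hf e he) (hle e he f hf)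
  refine le_of_mul_le_mul_left ?_ hβ
  calc (b : ℝ) ^ ((N : ℤ) * t f) * ∑ e ∈ I, w e
      ≤ (1 + 1 / b) * ∑ e ∈ I, w' e := by
        rw [Finset.mul_sum, Finset.mul_sum]
        refine Finset.sum_le_sum fun e he => ?_
        rw [← hteq e (hI he)]
        exact (ht e (hI he)).2
    _ ≤ (1 + 1 / b) * ∑ e ∈ Z, w' e := mul_le_mul_of_nonneg_left hIZ hc.le
    _ ≤ (1 + 1 / b) * ((1 + 1 / b) * ((b : ℝ) ^ ((N : ℤ) * t f) * ∑ e ∈ Z, w e)) := by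
        refine mul_le_mul_of_nonneg_left ?_ hc.le
        rw [Finset.mul_sum, Finset.mul_sum]
        refine Finset.sum_le_sum fun e he => ?_
        rw [← hteq e (hZ he)]
        exact (ht e (hZ he)).1
    _ = _ := by ring

/-- Weights in a common slot are rounded to the same scale, if the aspect ratio is small. -/
theorem slotScale_eq_of_aspectRatio {b p N σ : ℕ} {W x y : ℝ} (hb : 2 ≤ b)
    (hN : W * (b : ℝ) ^ p ≤ (b : ℝ) ^ N) (hx : 0 < x) (hy : 0 < y) (hxy : x ≤ W * y)
    (hyx : y ≤ W * x) (hx' : slotWeight b p N σ x ≠ 0) (hy' : slotWeight b p N σ y ≠ 0) :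
    slotScale b N σ x = slotScale b N σ y := by
  have hb0 : (0 : ℝ) < b := by exact_mod_cast (by omega : 0 < b)
  have hb1 : (1 : ℝ) ≤ b := by exact_mod_cast (by omega : 1 ≤ b)
  have key : ∀ {x y : ℝ}, 0 < x → 0 < y → x ≤ W * y → slotWeight b p N σ x ≠ 0 →
      slotWeight b p N σ y ≠ 0 → slotScale b N σ x ≤ slotScale b N σ y := by
    intro x y hx hy hxy hx' hy'
    by_contra! hlt
    have hW : 0 < W := pos_of_mul_pos_left (hx.trans_le hxy) hy.le
    have hd : (N : ℤ) ≤ slotScale b N σ x - slotScale b N σ y := by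
      refine Int.le_of_dvd (by linarith) ?_
      have := dvd_sub (dvd_slotScale_sub b N σ x) (dvd_slotScale_sub b N σ y)
      rwa [sub_sub_sub_cancel_right] at this
    have h1 := (slotWeight_spec hb hx hx').1
    have h2 := (slotWeight_spec hb hy hy').2.1
    have h3 : (b : ℝ) ^ (slotScale b N σ y + N) ≤ (b : ℝ) ^ (slotScale b N σ x + 1) :=
      zpow_le_zpow_right₀ hb1 (by linarith)
    have h4 : W * (b : ℝ) ^ (slotScale b N σ y + p) ≤ (b : ℝ) ^ (slotScale b N σ y + N) := by
      rw [zpow_add₀ hb0.ne', zpow_add₀ hb0.ne', zpow_natCast, zpow_natCast]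
      calc _ = (b : ℝ) ^ slotScale b N σ y * (W * (b : ℝ) ^ p) := by ring
        _ ≤ _ := mul_le_mul_of_nonneg_left hN (zpow_pos hb0 _).le
    have h5 := mul_lt_mul_of_pos_left h2 hW
    linarith
  exact le_antisymm (key hx hy hxy hx' hy') (key hy hx hyx hy' hx')

/-- The class of `x` with respect to the scales that are congruent to `j` modulo `p`. -/
theorem slotOffset_of_scale {b p N j : ℕ} (hp : 0 < p) (hpN : p ∣ N) (hN : 0 < N) (x : ℝ) :
    slotOffset b N (slotScale b p j x % N).toNat x = slotOffset b p j x ∧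
    slotScale b N (slotScale b p j x % N).toNat x = slotScale b p j x := by
  have hN' : (N : ℤ) ≠ 0 := by exact_mod_cast hN.ne'
  have h1 : slotOffset b N (slotScale b p j x % N).toNat x = slotOffset b p j x := by
    have h0 : 0 ≤ slotOffset b p j x := Int.emod_nonneg _ (by exact_mod_cast hp.ne')
    have h2 : slotOffset b p j x < N := lt_of_lt_of_le (Int.emod_lt_of_pos _ (by exact_mod_cast hp))
      (by exact_mod_cast Nat.le_of_dvd hN hpN)
    rw [slotOffset, Int.toNat_of_nonneg (Int.emod_nonneg _ hN')]
    have h3 : Int.log b x = slotOffset b p j x + slotScale b p j x := by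
      rw [slotScale]; ring
    rw [h3, add_sub_assoc, Int.add_emod, Int.emod_eq_zero_of_dvd
      (Int.dvd_self_sub_emod), add_zero, Int.emod_emod]
    exact Int.emod_eq_of_lt h0 h2
  refine ⟨h1, ?_⟩
  rw [slotScale, h1, slotScale]

/-! ### The classes of one offset -/

namespace MatroidPair

variable {n : ℕ}

theorem CommonIndep.mono {M : MatroidPair n} {X Y S T : Finset (Fin n)} (h : M.CommonIndep X S)
    (hTS : T ⊆ S) (hTY : T ⊆ Y) : M.CommonIndep Y T :=
  ⟨hTY, h.2.1.subset (Finset.coe_subset.2 hTS), h.2.2.subset (Finset.coe_subset.2 hTS)⟩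

/-- The scales of the classes of the weights on `E`, for the offset `j`. -/
noncomputable def scales (b p j : ℕ) (E : Finset (Fin n)) (w : Fin n → ℝ) : Finset ℤ :=
  (E.filter fun e => slotOffset b p j (w e) ≠ 0).image fun e => slotScale b p j (w e)

/-- The parameters of the reduction: weights are classified with respect to powers of `b`; a class
spans `p` powers, the slots recur after `N` powers, and `cnt` slots at distance `s` are used. -/
structure SlotParams (b p N s cnt : ℕ) (W : ℝ) : Prop where
  two_le : 2 ≤ b
  one_le : 1 ≤ W
  pos : 0 < p
  dvd : p ∣ N
  step_dvd : s ∣ p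
  mul_eq : s * cnt = N
  pos' : 0 < N
  sq_lt : 4 * W ^ 2 < (b : ℝ) ^ N
  le_pow : W * (b : ℝ) ^ p ≤ (b : ℝ) ^ N

variable {b p N s cnt : ℕ} {W : ℝ}

/-- Scales of an offset divisible by `s` are multiples of `s`, since `s` divides `p`; their residues
modulo `N` are therefore among the `cnt` slots in use. -/
theorem SlotParams.index (P : SlotParams b p N s cnt W) {j : ℕ} (hj : s ∣ j) (x : ℝ) :
    (slotScale b p j x % N).toNat / s < cnt ∧
      s * ((slotScale b p j x % N).toNat / s) = (slotScale b p j x % N).toNat := by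
  have hN : (0 : ℤ) < N := by exact_mod_cast P.pos'
  have h0 := Int.emod_nonneg (slotScale b p j x) hN.ne'
  have h1 := Int.emod_lt_of_pos (slotScale b p j x) hN
  have hs : 0 < s := Nat.pos_of_dvd_of_pos P.step_dvd P.pos
  have hd : s ∣ (slotScale b p j x % N).toNat := by
    have h2 : (s : ℤ) ∣ slotScale b p j x := by
      have h3 := (Int.natCast_dvd_natCast.2 P.step_dvd).trans (dvd_slotScale_sub b p j x)
      have h4 := dvd_add h3 (Int.natCast_dvd_natCast.2 hj)
      rwa [sub_add_cancel] at h4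
    have h5 : (s : ℤ) ∣ slotScale b p j x % N := by
      rw [Int.emod_def]
      exact dvd_sub h2 (dvd_mul_of_dvd_left
        (Int.natCast_dvd_natCast.2 (P.step_dvd.trans P.dvd)) _)
    rw [← Int.natCast_dvd_natCast, Int.toNat_of_nonneg h0]
    exact h5
  refine ⟨?_, Nat.mul_div_cancel' hd⟩
  rw [Nat.div_lt_iff_lt_mul hs, mul_comm, P.mul_eq]
  omega

theorem SlotParams.slotWeight_ne_zero (P : SlotParams b p N s cnt W) {j : ℕ} {x : ℝ} (hx : 0 < x)
    (h : slotOffset b p j x ≠ 0) : slotWeight b p N (slotScale b p j x % N).toNat x ≠ 0 := by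
  have hp : (0 : ℤ) < p := by exact_mod_cast P.pos
  have h1 := (slotOffset_of_scale (b := b) (j := j) P.pos P.dvd P.pos' x).1
  have h2 := le_slotWeight_of_slotOffset (b := b) (p := p) (N := N) P.two_le hx (by
    rw [h1]
    have h3 : 0 ≤ slotOffset b p j x := Int.emod_nonneg _ hp.ne'
    exact ⟨by omega, Int.emod_lt_of_pos _ hp⟩)
  have := P.two_le
  omega

/-- Folding and merging the solutions of the slots of one offset. -/
theorem sum_card_le_of_near_max (M : MatroidPair n) (P : SlotParams b p N s cnt W) {γ j : ℕ}
    (hj : s ∣ j) {E : Finset (Fin n)} {w : Fin n → ℝ} (hw : HasAspectRatio E w W)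
    (S : ℕ → Finset (Fin (γ * n)))
    (hS : ∀ i < cnt, (M.unfold γ).CommonIndep
      (copies γ E fun e => slotWeight b p N (s * i) (w e)) (S i))
    {C : ℝ} (hC : ∀ J ⊆ (Finset.range cnt).biUnion fun i => (S i).image (copyElt γ),
      M.CommonIndep E J → ∑ e ∈ J, w e ≤ C) :
    ∑ q ∈ scales b p j E w, (b : ℝ) ^ q * ((S ((q % N).toNat / s)).card : ℝ) ≤
      (1 + 4 / b) * C := by
  have hb0 : (0 : ℝ) < b := by exact_mod_cast (by have := P.two_le; omega : 0 < b)
  have hb1 : (1 : ℝ) ≤ b := by exact_mod_cast (by have := P.two_le; omega : 1 ≤ b)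
  have hb2 : (2 : ℝ) ≤ b := by exact_mod_cast P.two_le
  have hfold : ∀ q : ℤ, ∃ I : Finset (Fin n), q ∈ scales b p j E w →
      I ⊆ (S ((q % N).toNat / s)).image (copyElt γ) ∧ M.CommonIndep E I ∧
      (b : ℝ) ^ q * ((S ((q % N).toNat / s)).card : ℝ) ≤ ∑ e ∈ I, w e ∧
      (∀ e ∈ I, (b : ℝ) ^ (q + 1) ≤ w e ∧ w e ≤ (b : ℝ) ^ (q + p)) := by
    intro q
    by_cases hq : q ∈ scales b p j E w
    swap
    · exact ⟨∅, fun h => absurd h hq⟩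
    obtain ⟨e₀, he₀, rfl⟩ := Finset.mem_image.1 hq
    rw [Finset.mem_filter] at he₀
    obtain ⟨h1, h2⟩ := P.index hj (w e₀)
    set q := slotScale b p j (w e₀) with hqdef
    have hSi := hS _ h1
    rw [h2] at hSi
    obtain ⟨I, hI, hIE, hIc⟩ := M.exists_fold γ hSi
    have hpos : ∀ e ∈ I, slotWeight b p N (q % N).toNat (w e) ≠ 0 := by
      intro e he
      obtain ⟨x, hx, rfl⟩ := Finset.mem_image.1 (hI he)
      have := (mem_copies.1 (hSi.1 hx)).2
      rw [← this, copyWeight]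
      omega
    -- A slot knows its scale only modulo `N`. The aspect ratio forces every element of the slot
    -- onto the scale of `e₀`.
    have hscale : ∀ e ∈ I, slotScale b N (q % N).toNat (w e) = q := by
      intro e he
      rw [slotScale_eq_of_aspectRatio P.two_le P.le_pow (hw.1 e (hIE.1 he)) (hw.1 e₀ he₀.1)
        (hw.2 _ (hIE.1 he) _ he₀.1) (hw.2 _ he₀.1 _ (hIE.1 he)) (hpos e he)
        (P.slotWeight_ne_zero (hw.1 e₀ he₀.1) he₀.2)]
      exact (slotOffset_of_scale P.pos P.dvd P.pos' _).2
    refine ⟨I, fun _ => ⟨hI, hIE, ?_, fun e he => ?_⟩⟩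
    · calc (b : ℝ) ^ q * ((S ((q % N).toNat / s)).card : ℝ)
          ≤ (b : ℝ) ^ q * ((∑ e ∈ I, slotWeight b p N (q % N).toNat (w e) : ℕ) : ℝ) := by
            refine mul_le_mul_of_nonneg_left ?_ (zpow_pos hb0 _).le
            exact_mod_cast hIc
        _ = ∑ e ∈ I, slotWeight b p N (q % N).toNat (w e) * (b : ℝ) ^ q := by
            push_cast
            rw [mul_comm, Finset.sum_mul]
        _ ≤ ∑ e ∈ I, w e := by
            refine Finset.sum_le_sum fun e he => ?_
            have h3 := (slotWeight_spec P.two_le (hw.1 e (hIE.1 he)) (hpos e he)).2.2.1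
            rwa [hscale e he] at h3
    · have h3 := slotWeight_spec P.two_le (hw.1 e (hIE.1 he)) (hpos e he)
      rw [hscale e he] at h3
      exact ⟨h3.1, h3.2.1.le⟩
  choose I hI using hfold
  have hgap : ∀ q ∈ scales b p j E w, ∀ q' ∈ scales b p j E w, q < q' → q + p ≤ q' := by
    intro q hq q' hq' hlt
    obtain ⟨e, -, rfl⟩ := Finset.mem_image.1 hq
    obtain ⟨e', -, rfl⟩ := Finset.mem_image.1 hq'
    have h1 := dvd_sub (dvd_slotScale_sub b p j (w e')) (dvd_slotScale_sub b p j (w e))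
    rw [sub_sub_sub_cancel_right] at h1
    have := Int.le_of_dvd (by linarith) h1
    linarith
  have hUw : ∀ q ∈ scales b p j E w, ∀ q' ∈ scales b p j E w, q < q' →
      ∀ e ∈ I q', b * (b : ℝ) ^ (q + p) ≤ w e := by
    intro q hq q' hq' hlt e he
    refine le_trans ?_ ((hI q' hq').2.2.2 e he).1
    rw [← zpow_one_add₀ hb0.ne']
    refine zpow_le_zpow_right₀ hb1 ?_
    linarith [hgap q hq q' hq' hlt]
  obtain ⟨J, hJ, hJM, hJN, hJs⟩ := Matroid.exists_commonIndep_of_finset_biUnion M.M₁ M.M₂ w hb0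
    (fun q => (b : ℝ) ^ (q + p)) I (scales b p j E w)
    (fun q hq => (hI q hq).2.1.2.1) (fun q hq => (hI q hq).2.1.2.2)
    (fun q hq e he => ⟨(hw.1 e ((hI q hq).2.1.1 he)).le, ((hI q hq).2.2.2 e he).2⟩)
    (fun q _ => (zpow_pos hb0 _).le)
    (by
      intro q hq q' hq' hlt
      refine (mul_le_mul_of_nonneg_right hb2 (zpow_pos hb0 _).le).trans ?_
      rw [← zpow_one_add₀ hb0.ne']
      refine zpow_le_zpow_right₀ hb1 ?_
      have := hgap q hq q' hq' hlt
      have : (0 : ℤ) < p := by exact_mod_cast P.pos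
      linarith)
    hUw
    (by
      intro q hq q' hq' hlt
      rw [Finset.disjoint_left]
      intro e he he'
      have h1 := hUw q hq q' hq' hlt e he'
      have h2 := ((hI q hq).2.2.2 e he).2
      have h3 : (0 : ℝ) < (b : ℝ) ^ (q + p) := zpow_pos hb0 _
      nlinarith)
  calc ∑ q ∈ scales b p j E w, (b : ℝ) ^ q * ((S ((q % N).toNat / s)).card : ℝ)
      ≤ ∑ q ∈ scales b p j E w, ∑ e ∈ I q, w e :=
        Finset.sum_le_sum fun q hq => (hI q hq).2.2.1
    _ ≤ (1 + 4 / b) * ∑ e ∈ J, w e := hJs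
    _ ≤ (1 + 4 / b) * C := by
        refine mul_le_mul_of_nonneg_left (hC J ?_ ⟨?_, hJM, hJN⟩) (by positivity)
        · intro e he
          obtain ⟨q, hq, heq⟩ := Finset.mem_biUnion.1 (hJ he)
          obtain ⟨e₀, -, rfl⟩ := Finset.mem_image.1 hq
          exact Finset.mem_biUnion.2 ⟨_, Finset.mem_range.2 (P.index hj (w e₀)).1,
            (hI _ hq).1 heq⟩
        · intro e he
          obtain ⟨q, hq, heq⟩ := Finset.mem_biUnion.1 (hJ he)
          exact (hI q hq).2.1.1 heq

/-- The weight of a common independent set in the classes of one offset is bounded by the optima of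
the slots. -/
theorem sum_le_sum_commonRank (M : MatroidPair n) (P : SlotParams b p N s cnt W) {γ j : ℕ}
    (hγ : (b ^ p) ^ 2 ≤ γ) (hj : s ∣ j) {E T : Finset (Fin n)} {w : Fin n → ℝ}
    (hw : ∀ e ∈ E, 0 < w e) (hT : M.CommonIndep E T) :
    ∑ e ∈ T.filter (fun e => slotOffset b p j (w e) ≠ 0), w e ≤
      (1 + 1 / b) * ∑ q ∈ scales b p j E w, (b : ℝ) ^ q * ((M.unfold γ).commonRank
        (copies γ E fun e => slotWeight b p N (s * ((q % N).toNat / s)) (w e)) : ℝ) := by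
  have hb0 : (0 : ℝ) < b := by exact_mod_cast (by have := P.two_le; omega : 0 < b)
  rw [← Finset.sum_fiberwise_of_maps_to (g := fun e => slotScale b p j (w e))
    (t := scales b p j E w), Finset.mul_sum]
  swap
  · intro e he
    rw [Finset.mem_filter] at he
    exact Finset.mem_image_of_mem _ (Finset.mem_filter.2 ⟨hT.1 he.1, he.2⟩)
  refine Finset.sum_le_sum fun q hq => ?_
  obtain ⟨e₀, he₀, hq₀⟩ := Finset.mem_image.1 hq
  have hidx := (P.index hj (w e₀)).2
  rw [hq₀] at hidx
  rw [hidx]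
  set T' := (T.filter fun e => slotOffset b p j (w e) ≠ 0).filter
    fun e => slotScale b p j (w e) = q with hT'
  have hT'T : T' ⊆ T := (Finset.filter_subset _ _).trans (Finset.filter_subset _ _)
  have hT'E : M.CommonIndep E T' := hT.mono hT'T (hT'T.trans hT.1)
  -- The copies of this class of `T` are feasible in its slot, and their number is the rounded
  -- weight of the class.
  have hc := (M.commonIndep_copies γ hT'E
    fun e => slotWeight b p N (q % N).toNat (w e)).card_le_commonRank
  rw [card_copies] at hc
  swap
  · intro e he
    exact (Nat.pow_le_pow_left (slotWeight_lt P.two_le (hw e (hT'E.1 he))).le 2).trans hγ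
  have hc' : (∑ e ∈ T', (slotWeight b p N (q % N).toNat (w e) : ℝ)) ≤ ((M.unfold γ).commonRank
      (copies γ E fun e => slotWeight b p N (q % N).toNat (w e)) : ℝ) := by exact_mod_cast hc
  calc ∑ e ∈ T', w e
      ≤ ∑ e ∈ T', (1 + 1 / b) * (slotWeight b p N (q % N).toNat (w e) * (b : ℝ) ^ q) := by
        refine Finset.sum_le_sum fun e he => ?_
        simp only [hT', Finset.mem_filter] at he
        obtain ⟨⟨heT, h1⟩, h2⟩ := he
        have hwe := hw e (hT.1 heT)
        have h3 := P.slotWeight_ne_zero hwe h1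
        have h4 := (slotOffset_of_scale (b := b) (j := j) P.pos P.dvd P.pos' (w e)).2
        rw [h2] at h3 h4
        have h5 := (slotWeight_spec P.two_le hwe h3).2.2.2
        rwa [h4] at h5
    _ = (1 + 1 / b) * ((b : ℝ) ^ q * ∑ e ∈ T', (slotWeight b p N (q % N).toNat (w e) : ℝ)) := by
        rw [Finset.mul_sum, Finset.mul_sum]
        exact Finset.sum_congr rfl fun e _ => by ring
    _ ≤ _ := by gcongr

end MatroidPair

/-- For some offset only a small part of the weight of `T` lies outside the classes. -/
theorem exists_offset_sum_le {n b p s : ℕ} {W : ℝ} (hb : 2 ≤ b) (hp : 0 < p)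
    (hs : s = 1 ∨ ∃ h, p = 2 * h ∧ s = h ∧ W ≤ (b : ℝ) ^ (h - 1)) {T : Finset (Fin n)}
    {w : Fin n → ℝ} (hw : HasAspectRatio T w W) :
    ∃ j, s ∣ j ∧ (1 - 1 / p) * ∑ e ∈ T, w e ≤
      ∑ e ∈ T.filter (fun e => slotOffset b p j (w e) ≠ 0), w e := by
  have hp0 : (0 : ℝ) < p := by exact_mod_cast hp
  have hpz : (p : ℤ) ≠ 0 := by exact_mod_cast hp.ne'
  have hb0 : (0 : ℝ) < b := by exact_mod_cast (by omega : 0 < b)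
  have hb1 : (1 : ℝ) ≤ b := by exact_mod_cast (by omega : 1 ≤ b)
  have hsplit : ∀ j, ∑ e ∈ T, w e = ∑ e ∈ T.filter (fun e => slotOffset b p j (w e) = 0), w e +
      ∑ e ∈ T.filter (fun e => slotOffset b p j (w e) ≠ 0), w e := fun j =>
    (Finset.sum_filter_add_sum_filter_not T _ _).symm
  have hT0 : 0 ≤ ∑ e ∈ T, w e := Finset.sum_nonneg fun e he => (hw.1 e he).le
  rcases hs with rfl | ⟨h, rfl, rfl, hW⟩
  -- Averaging: each element is dropped for at most one of the `p` offsets, so they cannot all lose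
  -- more than a fraction `1 / p`.
  · by_contra! hcon
    have h1 : ∀ j ∈ Finset.range p, (∑ e ∈ T, w e) / p <
        ∑ e ∈ T.filter (fun e => slotOffset b p j (w e) = 0), w e := by
      intro j _
      have h2 := hcon j (one_dvd j)
      have h3 := hsplit j
      have h4 : (1 - 1 / (p : ℝ)) * ∑ e ∈ T, w e = ∑ e ∈ T, w e - (∑ e ∈ T, w e) / p := by ring
      linarith
    have h2 := Finset.sum_lt_sum_of_nonempty (Finset.nonempty_range_iff.2 hp.ne') h1
    rw [Finset.sum_const, Finset.card_range, nsmul_eq_mul, mul_div_cancel₀ _ hp0.ne'] at h2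
    simp only [Finset.sum_filter] at h2
    rw [Finset.sum_comm] at h2
    refine absurd h2 (not_lt.2 (Finset.sum_le_sum fun e he => ?_))
    rw [← Finset.sum_filter]
    have h3 : ((Finset.range p).filter fun j : ℕ => slotOffset b p j (w e) = 0).card ≤ 1 := by
      rw [Finset.card_le_one]
      intro i hi j hj
      rw [Finset.mem_filter, Finset.mem_range] at hi hj
      have h5 := dvd_sub (Int.dvd_of_emod_eq_zero hi.2) (Int.dvd_of_emod_eq_zero hj.2)
      rw [sub_sub_sub_cancel_left] at h5
      have h6 := Int.eq_zero_of_abs_lt_dvd h5 (by rw [abs_lt]; omega)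
      omega
    rw [Finset.sum_const, nsmul_eq_mul]
    have h4 : ((((Finset.range p).filter fun j : ℕ => slotOffset b p j (w e) = 0).card : ℕ) : ℝ) ≤
      1 := by exact_mod_cast h3
    have := mul_le_mul_of_nonneg_right h4 (hw.1 e he).le
    linarith
  -- For small `W` all logarithms lie in a window of fewer than `h` steps. Values congruent to `0`
  -- and to `h` modulo `2 * h` differ by at least `h`, so one of the offsets `0` and `h` drops
  -- nothing.
  · have hgap : ∀ e ∈ T, ∀ f ∈ T, Int.log b (w e) - Int.log b (w f) < s := by
      intro e he f hf
      by_contra! hge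
      have h1 := Int.zpow_log_le_self (b := b) (by omega) (hw.1 e he)
      have h2 := Int.lt_zpow_succ_log_self (b := b) (by omega) (w f)
      have h3 := hw.2 e he f hf
      have h4 : (b : ℝ) ^ ((s - 1 : ℕ) : ℤ) * (b : ℝ) ^ (Int.log b (w f) + 1) ≤
          (b : ℝ) ^ Int.log b (w e) := by
        rw [← zpow_add₀ hb0.ne']
        refine zpow_le_zpow_right₀ hb1 ?_
        omega
      rw [zpow_natCast] at h4
      have h5 : W * w f < (b : ℝ) ^ (s - 1) * (b : ℝ) ^ (Int.log b (w f) + 1) :=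
        lt_of_le_of_lt (mul_le_mul_of_nonneg_right hW (hw.1 f hf).le)
          (mul_lt_mul_of_pos_left h2 (by positivity))
      linarith
    have hone : (∀ e ∈ T, slotOffset b (2 * s) 0 (w e) ≠ 0) ∨
        ∀ e ∈ T, slotOffset b (2 * s) s (w e) ≠ 0 := by
      by_contra! hcon
      obtain ⟨⟨e, he, he0⟩, f, hf, hf0⟩ := hcon
      obtain ⟨a, ha⟩ := Int.dvd_of_emod_eq_zero he0
      obtain ⟨c, hc⟩ := Int.dvd_of_emod_eq_zero hf0
      have h1 := hgap e he f hf
      have h2 := hgap f hf e he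
      push_cast at ha hc
      have h3 : Int.log b (w e) - Int.log b (w f) = s * (2 * (a - c) - 1) := by linarith
      have hs0 : (0 : ℤ) < s := by omega
      rcases le_or_gt a c with h | h
      · nlinarith
      · nlinarith
    have hle : (1 - 1 / ((2 * s : ℕ) : ℝ)) * ∑ e ∈ T, w e ≤ ∑ e ∈ T, w e := by
      have : (0 : ℝ) ≤ 1 / ((2 * s : ℕ) : ℝ) := by positivity
      nlinarith
    rcases hone with h | h
    · exact ⟨0, dvd_zero _, by rwa [Finset.filter_true_of_mem h]⟩
    · exact ⟨s, dvd_rfl, by rwa [Finset.filter_true_of_mem h]⟩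

/-! ### Sending several messages -/

/-- A self-delimiting encoding of a bit string. -/
def frameMessage : List Bool → List Bool
  | [] => [false]
  | a :: l => true :: a :: frameMessage l

theorem length_frameMessage (l : List Bool) : (frameMessage l).length = 2 * l.length + 1 := by
  induction l with
  | nil => rfl
  | cons a l ih => simp [frameMessage, ih]; ring

theorem frameMessage_append_inj {l l' r r' : List Bool}
    (h : frameMessage l ++ r = frameMessage l' ++ r') : l = l' ∧ r = r' := by
  induction l generalizing l' with
  | nil => cases l' <;> simp_all [frameMessage]
  | cons a l ih =>
    cases l' with
    | nil => simp [frameMessage] at h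
    | cons a' l' =>
      simp only [frameMessage, List.cons_append, List.cons.injEq, true_and] at h
      obtain ⟨h1, h2⟩ := ih h.2
      exact ⟨by rw [h.1, h1], h2⟩

/-- The encoding of a list of bit strings as one bit string. -/
def encodeMessages : List (List Bool) → List Bool
  | [] => []
  | l :: L => frameMessage l ++ encodeMessages L

theorem encodeMessages_eq_nil {L : List (List Bool)} : encodeMessages L = [] ↔ L = [] := by
  cases L with
  | nil => simp [encodeMessages]
  | cons l L => cases l <;> simp [encodeMessages, frameMessage]

theorem encodeMessages_injective : Function.Injective encodeMessages := by
  intro L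
  induction L with
  | nil => exact fun L' h => (encodeMessages_eq_nil.1 h.symm).symm
  | cons l L ih =>
    intro L' h
    cases L' with
    | nil => exact absurd (encodeMessages_eq_nil.1 h) (by simp)
    | cons l' L' =>
      obtain ⟨h1, h2⟩ := frameMessage_append_inj h
      rw [h1, ih h2]

theorem length_encodeMessages_le {L : List (List Bool)} {C : ℝ}
    (h : ∀ l ∈ L, (2 * l.length + 1 : ℝ) ≤ C) : ((encodeMessages L).length : ℝ) ≤ L.length * C := by
  induction L with
  | nil => simp [encodeMessages]
  | cons l L ih =>
    have h1 := ih fun l' hl' => h l' (List.mem_cons_of_mem _ hl')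
    have h2 := h l List.mem_cons_self
    simp only [encodeMessages, List.length_append, length_frameMessage, List.length_cons]
    push_cast
    linarith

/-- The list of bit strings encoded by a bit string. -/
noncomputable def decodeMessages : List Bool → List (List Bool) :=
  Function.invFun encodeMessages

theorem decodeMessages_encodeMessages (L : List (List Bool)) :
    decodeMessages (encodeMessages L) = L :=
  Function.leftInverse_invFun encodeMessages_injective L

/-! ### The expectation -/

namespace OneWayProtocol

variable {X Y Z : Type} (P : OneWayProtocol X Y Z)

theorem expect_mono {f g : P.Coins → ℝ} (h : ∀ ω, f ω ≤ g ω) : P.expect f ≤ P.expect g :=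
  Finset.sum_le_sum fun ω _ => mul_le_mul_of_nonneg_left (h ω) ENNReal.toReal_nonneg

theorem expect_const_mul (c : ℝ) (f : P.Coins → ℝ) :
    P.expect (fun ω => c * f ω) = c * P.expect f := by
  rw [expect, expect, Finset.mul_sum]
  exact Finset.sum_congr rfl fun ω _ => by ring

theorem expect_sum {ι : Type*} (s : Finset ι) (f : ι → P.Coins → ℝ) :
    P.expect (fun ω => ∑ i ∈ s, f i ω) = ∑ i ∈ s, P.expect (f i) := by
  simp only [expect, Finset.mul_sum]
  exact Finset.sum_comm

theorem nonempty_coins : Nonempty P.Coins :=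
  ⟨P.law.support_nonempty.some⟩

end OneWayProtocol

/-! ### The reduction -/

namespace MatroidPair

variable {n : ℕ}

open Classical in
/-- The elements of `A` which are loops of neither matroid. -/
noncomputable def nonloops (M : MatroidPair n) (A : Finset (Fin n)) : Finset (Fin n) :=
  A.filter fun e => M.CommonIndep {e} {e}

theorem mem_nonloops {M : MatroidPair n} {A : Finset (Fin n)} {e : Fin n} :
    e ∈ M.nonloops A ↔ e ∈ A ∧ M.CommonIndep {e} {e} := by
  simp [nonloops]

theorem nonloops_subset (M : MatroidPair n) (A : Finset (Fin n)) : M.nonloops A ⊆ A :=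
  fun _ he => (mem_nonloops.1 he).1

theorem nonloops_union (M : MatroidPair n) (A B : Finset (Fin n)) :
    M.nonloops (A ∪ B) = M.nonloops A ∪ M.nonloops B := by
  ext e
  simp only [Finset.mem_union, mem_nonloops, or_and_right]

theorem CommonIndep.subset_nonloops {M : MatroidPair n} {A T : Finset (Fin n)}
    (h : M.CommonIndep A T) : T ⊆ M.nonloops A := fun _ he =>
  mem_nonloops.2 ⟨h.1 he, h.mono (Finset.singleton_subset_iff.2 he) subset_rfl⟩

theorem copies_union (γ : ℕ) (A B : Finset (Fin n)) (v : Fin n → ℕ) :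
    copies γ (A ∪ B) v = copies γ A v ∪ copies γ B v := by
  ext x
  simp only [Finset.mem_union, mem_copies, or_and_right]

theorem disjoint_copies {γ : ℕ} {A B : Finset (Fin n)} (h : Disjoint A B) (v : Fin n → ℕ) :
    Disjoint (copies γ A v) (copies γ B v) := by
  rw [Finset.disjoint_left]
  intro x hx hx'
  exact Finset.disjoint_left.1 h (mem_copies.1 hx).1 (mem_copies.1 hx').1

/-- The elements that have copies in the solutions of the slots. -/
def slotSupport {γ : ℕ} (cnt : ℕ) (S : ℕ → Finset (Fin (γ * n))) : Finset (Fin n) :=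
  (Finset.range cnt).biUnion fun i => (S i).image (copyElt γ)

/-- `Z` is of maximum weight among the common independent sets of elements with copies in `S`, for
some weights for which `S` might be a family of solutions of the slots. -/
def IsChoice (M : MatroidPair n) {γ : ℕ} (b p N s cnt : ℕ) (W : ℝ)
    (S : ℕ → Finset (Fin (γ * n))) (Z : Finset (Fin n)) : Prop :=
  M.CommonIndep (slotSupport cnt S) Z ∧ ∃ w : Fin n → ℝ, HasAspectRatio (slotSupport cnt S) w W ∧
    (∀ i < cnt, ∀ x ∈ S i, slotWeight b p N (s * i) (w (copyElt γ x)) = copyWeight γ x) ∧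
    ∀ J, M.CommonIndep (slotSupport cnt S) J → ∑ e ∈ J, w e ≤ ∑ e ∈ Z, w e

open Classical in
/-- The common independent set that is chosen, given the solutions of the slots. -/
noncomputable def choice (M : MatroidPair n) {γ : ℕ} (b p N s cnt : ℕ) (W : ℝ)
    (S : ℕ → Finset (Fin (γ * n))) : Finset (Fin n) :=
  if h : ∃ Z, M.IsChoice b p N s cnt W S Z then h.choose else ∅

variable {b p N s cnt : ℕ} {W : ℝ}

/-- The true weights are themselves admissible, so a choice exists. The weights actually used may be
others, but they give the same slot weights on the support and thus order common independent sets
alike up to `(1 + 1 / b) ^ 2`. -/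
theorem choice_spec (M : MatroidPair n) (P : SlotParams b p N s cnt W) {γ : ℕ}
    {E : Finset (Fin n)} {w : Fin n → ℝ} (hw : HasAspectRatio E w W)
    (S : ℕ → Finset (Fin (γ * n)))
    (hS : ∀ i < cnt, (M.unfold γ).CommonIndep
      (copies γ E fun e => slotWeight b p N (s * i) (w e)) (S i)) :
    M.CommonIndep E (M.choice b p N s cnt W S) ∧
    ∀ J ⊆ slotSupport cnt S, M.CommonIndep E J →
      ∑ e ∈ J, w e ≤ (1 + 1 / b) ^ 2 * ∑ e ∈ M.choice b p N s cnt W S, w e := by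
  classical
  have hmem : ∀ i < cnt, ∀ x ∈ S i, copyElt γ x ∈ E ∧
      copyWeight γ x = slotWeight b p N (s * i) (w (copyElt γ x)) := fun i hi x hx =>
    mem_copies.1 ((hS i hi).1 hx)
  have hR : slotSupport cnt S ⊆ E := by
    intro e he
    obtain ⟨i, hi, hei⟩ := Finset.mem_biUnion.1 he
    obtain ⟨x, hx, rfl⟩ := Finset.mem_image.1 hei
    exact (hmem i (Finset.mem_range.1 hi) x hx).1
  have hex : ∃ Z, M.IsChoice b p N s cnt W S Z := by
    obtain ⟨Z, hZ, hmax⟩ := Finset.exists_max_image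
      (Finset.univ.filter fun Z => M.CommonIndep (slotSupport cnt S) Z) (fun Z => ∑ e ∈ Z, w e)
      ⟨∅, Finset.mem_filter.2 ⟨Finset.mem_univ _, by simp [CommonIndep]⟩⟩
    exact ⟨Z, by simpa using hZ, w, hw.mono hR, fun i hi x hx => (hmem i hi x hx).2.symm,
      fun J hJ => hmax J (by simpa using hJ)⟩
  have hch : M.IsChoice b p N s cnt W S (M.choice b p N s cnt W S) := by
    rw [choice, dif_pos hex]
    exact hex.choose_spec
  obtain ⟨hZ, w', hw', hcand, hmax⟩ := hch
  refine ⟨hZ.mono subset_rfl (hZ.1.trans hR), fun J hJ hJE => ?_⟩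
  refine sum_le_of_slotWeight_eq (p := p) P.two_le P.one_le P.sq_lt (hw.mono hR) hw' ?_ hJ hZ.1
    (hmax J (hJE.mono subset_rfl hJ))
  intro e he
  obtain ⟨i, hi, hei⟩ := Finset.mem_biUnion.1 he
  obtain ⟨x, hx, rfl⟩ := Finset.mem_image.1 hei
  have h1 := (hmem i (Finset.mem_range.1 hi) x hx).2
  refine ⟨s * i, ?_, (hcand i (Finset.mem_range.1 hi) x hx).trans h1⟩
  rw [← h1, copyWeight]
  omega

end MatroidPair

/-! ### The weighted protocol and its analysis -/

namespace WeightedShare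

variable {n : ℕ}

/-- The weights of the party's elements, extended by zero. -/
noncomputable def extendWeight (X : WeightedShare n) (e : Fin n) : ℝ :=
  if h : e ∈ X.elements then X.weight ⟨e, h⟩ else 0

/-- The party's input of the unweighted instance for the slot `σ`. -/
noncomputable def unfold (γ b p N σ : ℕ) (X : WeightedShare n) : Share (γ * n) :=
  ⟨X.matroids.unfold γ, MatroidPair.copies γ (X.matroids.nonloops X.elements)
    fun e => slotWeight b p N σ (X.extendWeight e)⟩

theorem unfold_ofWeights (γ b p N σ : ℕ) (M : MatroidPair n) (A : Finset (Fin n))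
    (w : Fin n → ℝ) : (ofWeights M A w).unfold γ b p N σ =
      ⟨M.unfold γ, MatroidPair.copies γ (M.nonloops A) fun e => slotWeight b p N σ (w e)⟩ := by
  have h : MatroidPair.copies γ (M.nonloops A)
      (fun e => slotWeight b p N σ ((ofWeights M A w).extendWeight e)) =
      MatroidPair.copies γ (M.nonloops A) fun e => slotWeight b p N σ (w e) := by
    ext x
    rw [MatroidPair.mem_copies, MatroidPair.mem_copies]
    refine and_congr_right fun hx => ?_
    have hxA := M.nonloops_subset A hx
    simp [extendWeight, ofWeights, hxA]
  exact congrArg (Share.mk (M.unfold γ)) h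

end WeightedShare

open Classical in
/-- The weighted protocol which runs an unweighted protocol on the copies for each slot. -/
noncomputable def UnweightedProtocol.toWeighted {n γ : ℕ} (P : UnweightedProtocol (γ * n))
    (b p N s cnt : ℕ) (W : ℝ) : WeightedProtocol n where
  Coins := P.Coins
  law := P.law
  message ω X := if X.matroids.nonloops X.elements = ∅ then [] else
    encodeMessages ((List.range cnt).map fun i => P.message ω (X.unfold γ b p N (s * i)))
  output ω Y m := Y.matroids.choice b p N s cnt W fun i =>
    P.output ω (Y.unfold γ b p N (s * i))
      (if m = [] then P.message ω ⟨Y.matroids.unfold γ, ∅⟩ else (decodeMessages m).getD i [])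

namespace UnweightedProtocol

open MatroidPair

variable {n γ b p N s cnt : ℕ} {W : ℝ}

/-- An empty message means that Alice holds only loops: the encoding of a nonempty list is nonempty.
Bob then computes the messages for her empty share himself; otherwise he decodes them. -/
theorem exists_run_toWeighted_eq (P : UnweightedProtocol (γ * n)) (M : MatroidPair n)
    (A B : Finset (Fin n)) (w : Fin n → ℝ) (ω : P.Coins) :
    ∃ S : ℕ → Finset (Fin (γ * n)),
      (P.toWeighted b p N s cnt W).run ω (.ofWeights M A w) (.ofWeights M B w) =
        M.choice b p N s cnt W S ∧
      ∀ i < cnt, S i = P.run ω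
        ⟨M.unfold γ, copies γ (M.nonloops A) fun e => slotWeight b p N (s * i) (w e)⟩
        ⟨M.unfold γ, copies γ (M.nonloops B) fun e => slotWeight b p N (s * i) (w e)⟩ := by
  refine ⟨_, rfl, fun i hi => ?_⟩
  rw [← WeightedShare.unfold_ofWeights, ← WeightedShare.unfold_ofWeights]
  refine congrArg (P.output ω _) ?_
  change (if (if M.nonloops A = ∅ then [] else encodeMessages ((List.range cnt).map fun i =>
    P.message ω ((WeightedShare.ofWeights M A w).unfold γ b p N (s * i)))) = [] then
      P.message ω ⟨M.unfold γ, ∅⟩ else (decodeMessages (if M.nonloops A = ∅ then [] else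
        encodeMessages ((List.range cnt).map fun i =>
          P.message ω ((WeightedShare.ofWeights M A w).unfold γ b p N (s * i))))).getD i []) = _
  by_cases hA : M.nonloops A = ∅
  · rw [if_pos hA, if_pos rfl, WeightedShare.unfold_ofWeights, hA]
    have : copies γ (∅ : Finset (Fin n)) (fun e => slotWeight b p N (s * i) (w e)) = ∅ := by
      ext x
      simp [mem_copies]
    rw [this]
  · rw [if_neg hA, if_neg, decodeMessages_encodeMessages]
    · simp [hi]
    · rw [encodeMessages_eq_nil]
      intro h
      have := congrArg List.length h
      simp at this
      omega

/-- With silent messages Bob could not tell whether Alice holds one free element or none. He must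
answer `∅` in the second case, hence also in the first, where the optimum is one. This bound absorbs
the framing overhead of each message. -/
theorem one_le_of_usesBits {m : ℕ} {P : UnweightedProtocol m} {α : ℝ} {C : ℕ → ℝ} (hα : 0 < α)
    (hP : P.IsApprox α) (hC : P.UsesBits C) (hm : 0 < m) {r : ℕ} (hr : 1 ≤ r) : 1 ≤ C r := by
  set M : MatroidPair m := ⟨Matroid.freeOn Set.univ, Matroid.freeOn Set.univ, rfl, rfl⟩
  set e : Fin m := ⟨0, hm⟩
  have hr1 : ∀ A : Finset (Fin m), A ⊆ {e} → M.commonRank (A ∪ ∅) ≤ r := by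
    intro A hA
    rw [commonRank_le_iff]
    intro S hS
    rw [Finset.union_empty] at hS
    exact (Finset.card_le_card (hS.1.trans hA)).trans hr
  by_contra! hlt
  have hnil : ∀ A : Finset (Fin m), A ⊆ {e} → ∀ ω, P.message ω ⟨M, A⟩ = [] := by
    intro A hA ω
    have h := (hC M A ∅ (Finset.disjoint_empty_right A) r (hr1 A hA) ω).trans_lt hlt
    exact List.length_eq_zero_iff.1 (by exact_mod_cast Nat.lt_one_iff.1 (by exact_mod_cast h))
  obtain ⟨-, h2⟩ := hP M {e} ∅ (Finset.disjoint_empty_right _)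
  have h3 : ∀ ω, P.run ω ⟨M, {e}⟩ ⟨M, ∅⟩ = ∅ := by
    intro ω
    have h4 : P.run ω ⟨M, {e}⟩ ⟨M, ∅⟩ = P.run ω ⟨M, ∅⟩ ⟨M, ∅⟩ := by
      rw [OneWayProtocol.run, OneWayProtocol.run, hnil {e} subset_rfl, hnil ∅ (by simp)]
    rw [h4, ← Finset.subset_empty]
    simpa using ((hP M ∅ ∅ (Finset.disjoint_empty_right _)).1 ω).1
  have h5 : (1 : ℝ) ≤ M.commonRank ({e} ∪ ∅) := by
    have h6 : M.CommonIndep ({e} ∪ ∅) {e} := by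
      simp [CommonIndep, M]
    exact_mod_cast h6.card_le_commonRank
  simp only [h3, Finset.card_empty, Nat.cast_zero, OneWayProtocol.expect, mul_zero,
    Finset.sum_const_zero] at h2
  nlinarith

theorem nonneg_of_usesBits {m : ℕ} {P : UnweightedProtocol m} {C : ℕ → ℝ}
    (hC : P.UsesBits C) (r : ℕ) : 0 ≤ C r := by
  obtain ⟨ω⟩ := P.nonempty_coins
  refine le_trans (Nat.cast_nonneg _) (hC ⟨Matroid.freeOn Set.univ, Matroid.freeOn Set.univ, rfl,
    rfl⟩ ∅ ∅ (Finset.disjoint_empty_right _) r ?_ ω)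
  rw [commonRank_le_iff]
  intro S hS
  have : S = ∅ := by simpa using hS.1
  simp [this]

/-- A message of length `l` is framed in `2 * l + 1` bits, at most `3 * C (γ * r)` once `1 ≤ C (γ *
r)`. Removing loops secures this: either nothing is sent or the instance has rank at least one. -/
theorem toWeighted_usesBits (P : UnweightedProtocol (γ * n)) (Q : SlotParams b p N s cnt W)
    (hγ : (b ^ p) ^ 2 ≤ γ) {α : ℝ} (hα : 0 < α) {C : ℕ → ℝ} (hP : P.IsApprox α)
    (hC : P.UsesBits C) :
    (P.toWeighted b p N s cnt W).UsesBits W fun r => cnt * (3 * C (γ * r)) := by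
  intro M A B w hAB hw r hr ω
  have hbp : 0 < b ^ p := pow_pos (by have := Q.two_le; omega) p
  have hbγ : b ^ p ≤ γ := le_trans (Nat.le_self_pow two_ne_zero _) hγ
  change ((if M.nonloops A = ∅ then [] else encodeMessages ((List.range cnt).map fun i =>
    P.message ω ((WeightedShare.ofWeights M A w).unfold γ b p N (s * i)))).length : ℝ) ≤ _
  by_cases hA : M.nonloops A = ∅
  · rw [if_pos hA]
    have := nonneg_of_usesBits hC (γ * r)
    simp only [List.length_nil, Nat.cast_zero]
    positivity
  rw [if_neg hA]
  obtain ⟨e, he⟩ := Finset.nonempty_iff_ne_empty.2 hA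
  have hn : 0 < n := e.pos
  have hγ0 : 0 < γ := by omega
  have heAB : M.CommonIndep (A ∪ B) {e} := by
    rw [mem_nonloops] at he
    exact he.2.mono subset_rfl (Finset.singleton_subset_iff.2 (Finset.mem_union_left _ he.1))
  have hr1 : 1 ≤ r := by simpa using heAB.card_le_commonRank.trans hr
  have hC1 := one_le_of_usesBits hα hP hC (Nat.mul_pos hγ0 hn) (Nat.mul_pos hγ0 hr1)
  refine (length_encodeMessages_le (C := 3 * C (γ * r)) ?_).trans (by simp)
  intro l hl
  obtain ⟨i, -, rfl⟩ := List.mem_map.1 hl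
  rw [WeightedShare.unfold_ofWeights]
  have h := hC (M.unfold γ) (copies γ (M.nonloops A) fun e => slotWeight b p N (s * i) (w e)) ∅
    (Finset.disjoint_empty_right _) (γ * r) (by
      rw [Finset.union_empty]
      refine commonRank_unfold_le M γ _ _ (fun e he => ?_) (r := r) ?_
      · exact (slotWeight_lt Q.two_le (hw.1 e (Finset.mem_union_left _
          (M.nonloops_subset A he)))).le.trans hbγ
      · rw [commonRank_le_iff] at hr ⊢
        exact fun S hS => hr S (hS.mono subset_rfl
          (hS.1.trans ((M.nonloops_subset A).trans Finset.subset_union_left)))) ω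
  linarith

/-- The offset depends on the comparison set `T` and not on the coins. So the merging bound holds
for each coin outcome, and the guarantees of the slots add up in expectation even though they share
coins. -/
theorem toWeighted_isApprox (P : UnweightedProtocol (γ * n)) (Q : SlotParams b p N s cnt W)
    (hγ : (b ^ p) ^ 2 ≤ γ)
    (hs : s = 1 ∨ ∃ h, p = 2 * h ∧ s = h ∧ W ≤ (b : ℝ) ^ (h - 1)) {α ε : ℝ} (hα : 0 < α)
    (hε : (1 - ε) * ((1 + 1 / b) ^ 3 * (1 + 4 / b)) ≤ 1 - 1 / p) (hP : P.IsApprox α) :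
    (P.toWeighted b p N s cnt W).IsApprox W (α * (1 - ε)) := by
  intro M A B w hAB hw
  have hb0 : (0 : ℝ) < b := by exact_mod_cast (by have := Q.two_le; omega : 0 < b)
  set E := M.nonloops (A ∪ B) with hE
  have hEAB : E ⊆ A ∪ B := M.nonloops_subset _
  have hwE : HasAspectRatio E w W := hw.mono hEAB
  have hcop : ∀ v : Fin n → ℕ, copies γ (M.nonloops A) v ∪ copies γ (M.nonloops B) v =
      copies γ E v := fun v => by rw [hE, nonloops_union, copies_union]
  set S : ℕ → P.Coins → Finset (Fin (γ * n)) := fun i ω => P.run ω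
    ⟨M.unfold γ, copies γ (M.nonloops A) fun e => slotWeight b p N (s * i) (w e)⟩
    ⟨M.unfold γ, copies γ (M.nonloops B) fun e => slotWeight b p N (s * i) (w e)⟩ with hSdef
  have hrun : ∀ i, (∀ ω, (M.unfold γ).CommonIndep
      (copies γ E fun e => slotWeight b p N (s * i) (w e)) (S i ω)) ∧
      α * ((M.unfold γ).commonRank
        (copies γ E fun e => slotWeight b p N (s * i) (w e)) : ℝ) ≤
        P.expect fun ω => ((S i ω).card : ℝ) := by
    intro i
    have h := hP (M.unfold γ) _ _ (disjoint_copies (γ := γ) (hAB.mono (M.nonloops_subset A)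
      (M.nonloops_subset B)) fun e => slotWeight b p N (s * i) (w e))
    rwa [hcop] at h
  have hout : ∀ ω : P.Coins, ∃ S' : ℕ → Finset (Fin (γ * n)),
      (P.toWeighted b p N s cnt W).run ω (.ofWeights M A w) (.ofWeights M B w) =
        M.choice b p N s cnt W S' ∧ ∀ i < cnt, S' i = S i ω :=
    fun ω => P.exists_run_toWeighted_eq M A B w ω
  have hS' : ∀ {S' : ℕ → Finset (Fin (γ * n))} {ω}, (∀ i < cnt, S' i = S i ω) → ∀ i < cnt,
      (M.unfold γ).CommonIndep (copies γ E fun e => slotWeight b p N (s * i) (w e)) (S' i) := by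
    intro S' ω h i hi
    rw [h i hi]
    exact (hrun i).1 ω
  refine ⟨fun ω => ?_, fun T hT => ?_⟩
  · obtain ⟨S', h1, h2⟩ := hout ω
    have h3 := (M.choice_spec Q hwE S' (hS' h2)).1
    refine h3.mono ?_ ?_ |> (h1 ▸ ·)
    · exact subset_rfl
    · exact h3.1.trans hEAB
  have hTE : M.CommonIndep E T := hT.mono subset_rfl hT.subset_nonloops
  obtain ⟨j, hj, hjT⟩ := exists_offset_sum_le Q.two_le Q.pos hs (hwE.mono hTE.1)
  set D : ℝ := (1 + 1 / b) ^ 3 * (1 + 4 / b) with hD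
  have hD0 : 0 < D := by positivity
  set wt : P.Coins → ℝ := fun ω => ∑ e ∈ (P.toWeighted b p N s cnt W).run ω
    (.ofWeights M A w) (.ofWeights M B w), w e with hwt
  have hT0 : 0 ≤ ∑ e ∈ T, w e := Finset.sum_nonneg fun e he => (hw.1 e (hT.1 he)).le
  have hpoint : ∀ ω, ∑ q ∈ scales b p j E w,
      (b : ℝ) ^ q * ((S ((q % N).toNat / s) ω).card : ℝ) ≤
        (1 + 4 / b) * (1 + 1 / b) ^ 2 * wt ω := by
    intro ω
    obtain ⟨S', h1, h2⟩ := hout ω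
    have h3 := M.sum_card_le_of_near_max Q hj hwE S' (hS' h2)
      (M.choice_spec Q hwE S' (hS' h2)).2
    rw [← h1] at h3
    rw [mul_assoc]
    refine le_trans (le_of_eq (Finset.sum_congr rfl fun q hq => ?_)) h3
    obtain ⟨e₀, -, rfl⟩ := Finset.mem_image.1 hq
    rw [h2 _ (Q.index hj (w e₀)).1]
  have hmain : α * ((1 - 1 / p) * ∑ e ∈ T, w e) ≤ D * P.expect wt := by
    calc α * ((1 - 1 / p) * ∑ e ∈ T, w e)
        ≤ α * ((1 + 1 / b) * ∑ q ∈ scales b p j E w, (b : ℝ) ^ q * ((M.unfold γ).commonRank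
          (copies γ E fun e => slotWeight b p N (s * ((q % N).toNat / s)) (w e)) : ℝ)) :=
          mul_le_mul_of_nonneg_left
            (hjT.trans (M.sum_le_sum_commonRank Q hγ hj hwE.1 hTE)) hα.le
      _ = (1 + 1 / b) * ∑ q ∈ scales b p j E w, (b : ℝ) ^ q * (α * ((M.unfold γ).commonRank
          (copies γ E fun e => slotWeight b p N (s * ((q % N).toNat / s)) (w e)) : ℝ)) := by
          rw [mul_left_comm, Finset.mul_sum]
          congr 1
          exact Finset.sum_congr rfl fun q _ => by ring
      _ ≤ (1 + 1 / b) * ∑ q ∈ scales b p j E w,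
          (b : ℝ) ^ q * P.expect fun ω => ((S ((q % N).toNat / s) ω).card : ℝ) := by
          gcongr with q
          exact (hrun _).2
      _ = (1 + 1 / b) * P.expect fun ω => ∑ q ∈ scales b p j E w,
          (b : ℝ) ^ q * ((S ((q % N).toNat / s) ω).card : ℝ) := by
          rw [P.expect_sum]
          simp only [P.expect_const_mul]
      _ ≤ (1 + 1 / b) * P.expect fun ω => (1 + 4 / b) * (1 + 1 / b) ^ 2 * wt ω :=
          mul_le_mul_of_nonneg_left (P.expect_mono hpoint) (by positivity)
      _ = D * P.expect wt := by
          rw [P.expect_const_mul, hD]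
          ring
  have h1 : α * (1 - ε) * ∑ e ∈ T, w e ≤ P.expect wt := by
    refine le_of_mul_le_mul_left ?_ hD0
    refine le_trans ?_ hmain
    have := mul_le_mul_of_nonneg_left (mul_le_mul_of_nonneg_right hε hT0) hα.le
    linarith
  exact h1

end UnweightedProtocol

/-! ### The parameters -/

theorem exists_slotParams {ε : ℝ} (hε : 0 < ε) (hε1 : ε < 1) {W : ℝ} (hW : 1 ≤ W) :
    ∃ b p N s cnt : ℕ, MatroidPair.SlotParams b p N s cnt W ∧
      (b ^ p) ^ 2 ≤ gammaFactor (ε / 15) ∧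
      (s = 1 ∨ ∃ h, p = 2 * h ∧ s = h ∧ W ≤ (b : ℝ) ^ (h - 1)) ∧
      (1 - ε) * ((1 + 1 / b) ^ 3 * (1 + 4 / b)) ≤ 1 - 1 / p ∧
      (cnt : ℝ) ≤ 17 * (1 + Real.log W) := by
  -- The seven factors' worth of first-order loss, `3 / b + 4 / b`, is at most `ε / 2`, and `p ≥ 2 /
  -- ε` leaves `1 / p ≤ ε / 2` for the offset. Also `b ≤ 15 / ε` and `2 * p ≤ 12 / ε`, which is
  -- where `ε / 15` comes from.
  set b : ℕ := ⌈14 / ε⌉₊ with hb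
  set h : ℕ := ⌈1 / ε⌉₊ + 1 with hh
  set p : ℕ := 2 * h with hp
  set m : ℕ := ⌈Real.log W / p⌉₊ + 3 with hm
  have hb1 : 14 / ε ≤ b := Nat.le_ceil _
  have hb2 : (b : ℝ) ≤ 15 / ε := by
    have h1 : (b : ℝ) < 14 / ε + 1 := Nat.ceil_lt_add_one (by positivity)
    have h2 : (1 : ℝ) ≤ 1 / ε := (one_le_div hε).2 hε1.le
    have h3 : 15 / ε = 14 / ε + 1 / ε := by ring
    linarith
  have h1ε : (1 : ℝ) ≤ 1 / ε := (one_le_div hε).2 hε1.le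
  have hb14 : (14 : ℝ) ≤ b := by
    have h3 : 14 / ε = 14 * (1 / ε) := by ring
    linarith
  have hb0 : (0 : ℝ) < b := by linarith
  have hh1 : 1 / ε + 1 ≤ h := by
    rw [hh]; push_cast; linarith [Nat.le_ceil (1 / ε)]
  have hh2 : (h : ℝ) ≤ 3 * (1 / ε) := by
    have h1 : (⌈1 / ε⌉₊ : ℝ) < 1 / ε + 1 := Nat.ceil_lt_add_one (by positivity)
    rw [hh]; push_cast; linarith
  have hh3 : (2 : ℝ) ≤ h := by linarith
  have hh4 : 2 ≤ h := by exact_mod_cast hh3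
  have hpr : (p : ℝ) = 2 * h := by rw [hp]; push_cast; ring
  have hp0 : (0 : ℝ) < p := by linarith
  have hlog : 0 ≤ Real.log W := Real.log_nonneg hW
  have hexp2 : Real.exp 2 ≤ b := by
    have h1 := Real.exp_one_lt_d9
    have h2 : Real.exp 2 = Real.exp 1 * Real.exp 1 := by rw [← Real.exp_add]; norm_num
    have h3 := Real.exp_pos 1
    rw [h2]
    nlinarith
  have hbpow : ∀ k : ℕ, Real.exp (2 * k) ≤ (b : ℝ) ^ k := by
    intro k
    rw [mul_comm, Real.exp_nat_mul]
    exact pow_le_pow_left₀ (Real.exp_pos 2).le hexp2 k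
  have hWexp : W = Real.exp (Real.log W) := (Real.exp_log (by linarith)).symm
  have hm1 : Real.log W + 3 * p ≤ p * m := by
    rw [hm]
    push_cast
    have := mul_le_mul_of_nonneg_left (Nat.le_ceil (Real.log W / p)) hp0.le
    rw [mul_div_cancel₀ _ hp0.ne'] at this
    linarith
  have hm2 : (m : ℝ) ≤ Real.log W / p + 4 := by
    have h1 : (⌈Real.log W / p⌉₊ : ℝ) < Real.log W / p + 1 := Nat.ceil_lt_add_one (by positivity)
    rw [hm]; push_cast; linarith
  have hm3 : 3 ≤ m := by omega
  -- Using every slot would cost about `p` runs even for `W = 1`. Small `W` needs only the two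
  -- offsets `0` and `h`, hence `2 * m` slots; for large `W`, `p ≤ 4 * log W` bounds the count `p *
  -- m ≤ log W + 4 * p`.
  set s : ℕ := if W ≤ (b : ℝ) ^ (h - 1) then h else 1 with hs
  set cnt : ℕ := if W ≤ (b : ℝ) ^ (h - 1) then 2 * m else p * m with hcnt
  refine ⟨b, p, p * m, s, cnt, ⟨?_, hW, ?_, dvd_mul_right p m, ?_, ?_, ?_, ?_, ?_⟩, ?_, ?_, ?_, ?_⟩
  · have : (2 : ℝ) ≤ b := by linarith
    exact_mod_cast this
  · omega
  · rw [hs]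
    split_ifs
    · exact dvd_mul_left h 2
    · exact one_dvd p
  · rw [hs, hcnt]
    split_ifs
    · rw [hp]; ring
    · ring
  · exact Nat.mul_pos (by omega) (by omega)
  · refine lt_of_lt_of_le ?_ (hbpow _)
    have h1 : Real.exp (2 * Real.log W + 2) ≤ Real.exp (2 * ((p * m : ℕ) : ℝ)) := by
      rw [Real.exp_le_exp]
      push_cast
      linarith
    refine lt_of_lt_of_le ?_ h1
    have h2 : Real.exp (2 * Real.log W) = W ^ 2 := by
      rw [show (2 : ℝ) * Real.log W = ((2 : ℕ) : ℝ) * Real.log W by norm_num, Real.exp_nat_mul,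
        ← hWexp]
    have h3 : (4 : ℝ) < Real.exp 2 := by
      have h4 := Real.exp_one_gt_d9
      have h2 : Real.exp 2 = Real.exp 1 * Real.exp 1 := by rw [← Real.exp_add]; norm_num
      rw [h2]
      nlinarith
    rw [Real.exp_add, h2, mul_comm]
    exact mul_lt_mul_of_pos_left h3 (by positivity)
  · have h1 : p * m = p + p * (m - 1) := by
      obtain ⟨k, hk⟩ : ∃ k, m = k + 1 := ⟨m - 1, by omega⟩
      rw [hk, Nat.add_sub_cancel]; ring
    rw [h1, pow_add, mul_comm]
    refine mul_le_mul_of_nonneg_left ?_ (by positivity)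
    refine le_trans ?_ (hbpow _)
    rw [hWexp, Real.exp_le_exp]
    have h2 : ((p * m : ℕ) : ℝ) = p + ((p * (m - 1) : ℕ) : ℝ) := by exact_mod_cast h1
    rw [Nat.cast_mul] at h2
    linarith
  · rw [← @Nat.cast_le ℝ, ← pow_mul]
    refine le_trans ?_ (Nat.le_ceil _)
    push_cast
    rw [one_div_div, ← Real.rpow_natCast]
    refine (Real.rpow_le_rpow hb0.le hb2 (by positivity)).trans
      (Real.rpow_le_rpow_of_exponent_le (hb14.trans hb2 |> le_trans (by norm_num)) ?_)
    push_cast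
    have h3 : 15 / ε = 15 * (1 / ε) := by ring
    rw [hpr, h3]
    linarith
  · rw [hs]
    split_ifs with hc
    · exact Or.inr ⟨h, rfl, rfl, hc⟩
    · exact Or.inl rfl
  · set y : ℝ := 1 / b with hy
    have hy0 : 0 < y := by positivity
    have hyε : y ≤ ε / 14 := by
      rw [hy, div_le_div_iff₀ hb0 (by norm_num)]
      rw [div_le_iff₀ hε] at hb1
      linarith
    have hpε : 1 / (p : ℝ) ≤ ε / 2 := by
      rw [div_le_div_iff₀ hp0 (by norm_num), hpr]
      have : ε * (1 / ε) = 1 := by field_simp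
      nlinarith
    have h4 : (4 : ℝ) / b = 4 * y := by rw [hy]; ring
    rw [h4]
    have h5 : (1 - ε) * ((1 + y) ^ 3 * (1 + 4 * y)) ≤
        (1 - ε) * ((1 + ε / 14) ^ 3 * (1 + 4 * (ε / 14))) := by
      have : 0 ≤ 1 - ε := by linarith
      gcongr
    refine h5.trans ?_
    have h6 : (1 - ε) * ((1 + ε / 14) ^ 3 * (1 + 4 * (ε / 14))) ≤ 1 - ε / 2 := by
      set z := ε / 14 with hz
      have hεz : ε = 14 * z := by rw [hz]; ring
      have hz0 : 0 < z := by positivity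
      rw [hεz]
      have e1 : (1 - 14 * z) * ((1 + z) ^ 3 * (1 + 4 * z)) =
          1 - 14 * z / 2 - (83 * z ^ 2 + 197 * z ^ 3 + 178 * z ^ 4 + 56 * z ^ 5) := by ring
      rw [e1]
      have : 0 ≤ 83 * z ^ 2 + 197 * z ^ 3 + 178 * z ^ 4 + 56 * z ^ 5 := by positivity
      linarith
    linarith
  · rw [hcnt]
    split_ifs with hc
    · push_cast
      have : Real.log W / p ≤ Real.log W / 2 := by
        refine div_le_div_of_nonneg_left hlog (by norm_num) ?_
        linarith
      linarith
    · push_cast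
      have h1 : (p : ℝ) ≤ 4 * Real.log W := by
        have h2 := (hbpow (h - 1)).trans (not_le.1 hc).le
        rw [hWexp, Real.exp_le_exp, Nat.cast_sub (by omega)] at h2
        push_cast at h2
        rw [hpr]
        linarith
      have h3 := mul_le_mul_of_nonneg_left hm2 hp0.le
      rw [mul_add, mul_div_cancel₀ _ hp0.ne'] at h3
      linarith

theorem mainTheorem5 :
    ∃ c K : ℝ, 1 ≤ c ∧ 0 < K ∧
      ∀ (ε α : ℝ), 0 < ε → 0 < α → α ≤ 1 →
      ∀ (Pu : ∀ n : ℕ, UnweightedProtocol n) (Cu : ℕ → ℕ → ℝ),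
        (∀ n, (Pu n).IsApprox α) →
        (∀ n, (Pu n).UsesBits (Cu n)) →
        ∃ Pw : ∀ (n : ℕ) (_W : ℝ), WeightedProtocol n,
          (∀ (n : ℕ) (W : ℝ), 1 ≤ W →
            (Pw n W).IsApprox W (α * (1 - ε)) ∧
            (Pw n W).UsesBits W (fun r =>
              K * (Cu (gammaFactor (ε / c) * n) (gammaFactor (ε / c) * r) *
                (1 + Real.log W)))) ∧
          ((∀ n, (Pu n).IsDeterministic) → ∀ n W, (Pw n W).IsDeterministic) := by
  -- The constant `51` is `3 * 17`: framing times the bound on the number of slots.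
  refine ⟨15, 51, by norm_num, by norm_num, ?_⟩
  intro ε α hε hα _ Pu Cu hPu hCu
  rcases lt_or_ge ε 1 with hε1 | hε1
  · have hpar : ∀ W : ℝ, ∃ b p N s cnt : ℕ, 1 ≤ W → MatroidPair.SlotParams b p N s cnt W ∧
        (b ^ p) ^ 2 ≤ gammaFactor (ε / 15) ∧
        (s = 1 ∨ ∃ h, p = 2 * h ∧ s = h ∧ W ≤ (b : ℝ) ^ (h - 1)) ∧
        (1 - ε) * ((1 + 1 / b) ^ 3 * (1 + 4 / b)) ≤ 1 - 1 / p ∧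
        (cnt : ℝ) ≤ 17 * (1 + Real.log W) := by
      intro W
      by_cases hW : 1 ≤ W
      · obtain ⟨b, p, N, s, cnt, h⟩ := exists_slotParams hε hε1 hW
        exact ⟨b, p, N, s, cnt, fun _ => h⟩
      · exact ⟨0, 0, 0, 0, 0, fun h => absurd h hW⟩
    choose b p N s cnt hpar using hpar
    refine ⟨fun n W => (Pu (gammaFactor (ε / 15) * n)).toWeighted (b W) (p W) (N W) (s W)
      (cnt W) W, fun n W hW => ?_, fun hdet n W => hdet _⟩
    obtain ⟨hQ, hγ, hs, hbp, hcnt⟩ := hpar W hW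
    refine ⟨UnweightedProtocol.toWeighted_isApprox _ hQ hγ hs hα hbp (hPu _), ?_⟩
    intro M A B w hAB hw r hr ω
    refine (UnweightedProtocol.toWeighted_usesBits _ hQ hγ hα (hPu _) (hCu _) M A B w hAB hw r hr
      ω).trans ?_
    have h0 := UnweightedProtocol.nonneg_of_usesBits (hCu (gammaFactor (ε / 15) * n))
      (gammaFactor (ε / 15) * r)
    have h1 := mul_le_mul_of_nonneg_right hcnt h0
    linarith
  -- For `ε ≥ 1` the required ratio is not positive, so silence and the empty answer suffice.
  · refine ⟨fun n W => ⟨Unit, PMF.pure (), fun _ _ => [], fun _ _ _ => ∅⟩, fun n W hW => ⟨?_, ?_⟩,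
      fun _ _ _ => inferInstanceAs (Subsingleton Unit)⟩
    · intro M A B w hAB hw
      refine ⟨fun ω => ⟨by simp [OneWayProtocol.run], by simp [OneWayProtocol.run],
        by simp [OneWayProtocol.run]⟩, fun T hT => ?_⟩
      have h1 : 0 ≤ ∑ e ∈ T, w e := Finset.sum_nonneg fun e he => (hw.1 e (hT.1 he)).le
      simp only [OneWayProtocol.expect, OneWayProtocol.run, Finset.sum_empty, mul_zero,
        Finset.sum_const_zero]
      exact mul_nonpos_of_nonpos_of_nonneg
        (mul_nonpos_of_nonneg_of_nonpos hα.le (by linarith)) h1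
    · intro M A B w hAB hw r hr ω
      have h0 := UnweightedProtocol.nonneg_of_usesBits (hCu (gammaFactor (ε / 15) * n))
        (gammaFactor (ε / 15) * r)
      have h1 := Real.log_nonneg hW
      simp only [List.length_nil, Nat.cast_zero]
      positivity
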